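/- **Clar covers.** Let $G$ be a finite simple graph. A *Clar cover* of $G$ is a spanning subgraph of $G$ each of whose connected components is either a complete graph $K_2$ or a hexagon (6-cycle) $C_6$; its *order* is the number of its components that are hexagons. Let $c_k$ be the number of Clar covers of $G$ of order $k$ and $Cl$ the maximal order of a Clar cover (the Clar number). The *Zhang–Zhang (Clar covering) polynomial* of $G$ is $\mathrm{ZZ}(G,x)=\sum_{k=0}^{Cl}c_k x^k$. **Parallelograms and ribbons.** Consider the honeycomb lattice of regular hexagons with two vertical edges each, and let $(i,j)$ denote the hexagon reached from a fixed hexagon $(0,0)$ by $i$ steps to the lower-left neighbour and $j$ steps to the lower-right neighbour. A finite set of hexagons determines the graph consisting of all their vertices and sides. For integers $m,n\ge 0$, the parallelogram $M(m,n)$ is the graph of the hexagons $(i,j)$ with $0\le i<n$, $0\le j<m$. For integers $n_1,n_2,m_1,m_2\ge 0$, the ribbon $Rb(n_1,n_2,m_1,m_2)$ is the graph of the hexagons $(i,j)$ with $0\le i<n_1+n_2$, $0\le j<m_1$ (upper arm) or $n_2\le i<n_1+n_2$, $0\le j<m_1+m_2$ (lower arm). (The graph of the empty set of hexagons is empty,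 and its ZZ polynomial is $1$.) For $k_1\le n$ and $k_2\le m$ put $V(k_1,k_2,m,n)=Rb(k_1,n-k_1,k_2,m-k_2)$, and for $k\le m$, $k\le n$ put $V(k,m,n)=V(k,k,m,n)$. **Theorem.** For all integers $n_1,n_2,m_1,m_2\ge 0$, $$\mathrm{ZZ}(Rb(n_1,n_2,m_1,m_2),x)=\sum_{k=0}^{\min(n_1,m_1)}\mathrm{ZZ}(M(m_1-k,n_2+k),x)\,\mathrm{ZZ}(M(m_2+k,n_1-k),x)+x\sum_{k=1}^{\min(n_1,m_1)}\mathrm{ZZ}(M(m_1-k,n_2-1+k),x)\,\mathrm{ZZ}(M(m_2-1+k,n_1-k),x).$$ For all $m,n\ge 0$, $$\mathrm{ZZ}(M(m,n),x)=\sum_{j=0}^{\min(m,n)}\binom mj\binom nj(1+x)^j={}_2F_1(-m,-n;1;1+x).$$ Consequently $$\mathrm{ZZ}(Rb(n_1,n_2,m_1,m_2),x)=\sum_{k=0}^{\min(n_1,m_1)}{}_2F_1(-m_1+k,-n_2-k;1;1+x)\,{}_2F_1(-n_1+k,-m_2-k;1;1+x)+x\sum_{k=1}^{\min(n_1,m_1)}{}_2F_1(-m_1+k,-n_2+1-k;1;1+x)\,{}_2F_1(-n_1+k,-m_2+1-k;1;1+x)$$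 (for every complex number $x$), that is, $$\mathrm{ZZ}(Rb(n_1,n_2,m_1,m_2),x)=\sum_{k=0}^{\min(n_1,m_1)}\sum_{j=0}^{m_1-k}\sum_{i=0}^{n_1-k}\binom{m_1-k}{j}\binom{n_2+k}{j}\binom{m_2+k}{i}\binom{n_1-k}{i}(1+x)^{i+j}+x\sum_{k=1}^{\min(n_1,m_1)}\sum_{j=0}^{m_1-k}\sum_{i=0}^{n_1-k}\binom{m_1-k}{j}\binom{n_2-1+k}{j}\binom{m_2-1+k}{i}\binom{n_1-k}{i}(1+x)^{i+j}.$$ In particular, for $0\le k\le\min(m,n)$, $$\mathrm{ZZ}(V(k,m,n),x)=\sum_{s=0}^{k}\sum_{j=0}^{k-s}\sum_{i=0}^{k-s}\binom{k-s}{j}\binom{n-k+s}{j}\binom{m-k+s}{i}\binom{k-s}{i}(1+x)^{i+j}+x\sum_{s=1}^{k}\sum_{j=0}^{k-s}\sum_{i=0}^{k-s}\binom{k-s}{j}\binom{n-k-1+s}{j}\binom{m-k-1+s}{i}\binom{k-s}{i}(1+x)^{i+j},$$ and, for $0\le k_1\le n$ and $0\le k_2\le m$, $$\mathrm{ZZ}(V(k_1,k_2,m,n),x)=\sum_{k=0}^{\min(k_1,k_2)}\sum_{j=0}^{k_2-k}\sum_{i=0}^{k_1-k}\binom{k_2-k}{j}\binom{n-k_1+k}{j}\binom{m-k_2+k}{i}\binom{k_1-k}{i}(1+x)^{i+j}+x\sum_{k=1}^{\min(k_1,k_2)}\sum_{j=0}^{k_2-k}\sum_{i=0}^{k_1-k}\binom{k_2-k}{j}\binom{n-k_1-1+k}{j}\binom{m-k_2-1+k}{i}\binom{k_1-k}{i}(1+x)^{i+j}.$$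 -/

import Mathlib

open Polynomial

noncomputable section

/-! ### Clar covers and the Zhang-Zhang polynomial of a graph -/

section ClarCovers

variable {V : Type*}

/-- A connected component of `H` that is a complete graph on two vertices (a double bond). -/
def IsDoubleBond {H : SimpleGraph V} (c : H.ConnectedComponent) : Prop :=
  Nonempty (c.toSimpleGraph ≃g (⊤ : SimpleGraph (Fin 2)))

/-- A connected component of `H` that is a cycle on six vertices (an aromatic sextet). -/
def IsSextet {H : SimpleGraph V} (c : H.ConnectedComponent) : Prop :=
  Nonempty (c.toSimpleGraph ≃g SimpleGraph.cycleGraph 6)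

/-- A Clar cover of `G`: a spanning subgraph, i.e. a graph `H ≤ G` on the same vertex set, each of
whose connected components is a `K₂` or a hexagon `C₆`. -/
def IsClarCover (G H : SimpleGraph V) : Prop :=
  H ≤ G ∧ ∀ c : H.ConnectedComponent, IsDoubleBond c ∨ IsSextet c

/-- The order of a Clar cover: its number of hexagons. -/
def clarOrder (H : SimpleGraph V) : ℕ :=
  {c : H.ConnectedComponent | IsSextet c}.ncard

/-- The number `c_k` of Clar covers of order `k`. -/
def clarCount (G : SimpleGraph V) (k : ℕ) : ℕ :=
  {H : SimpleGraph V | IsClarCover G H ∧ clarOrder H = k}.ncard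

/-- The Clar number of a finite graph: the maximal order of a Clar cover. -/
def clarNumber (G : SimpleGraph V) : ℕ :=
  sSup {k : ℕ | ∃ H : SimpleGraph V, IsClarCover G H ∧ clarOrder H = k}

/-- The Zhang-Zhang (Clar covering) polynomial `∑_{k=0}^{Cl} c_k x^k` of a finite graph. -/
def ZZ [Finite V] (G : SimpleGraph V) : ℤ[X] :=
  ∑ k ∈ Finset.range (clarNumber G + 1), C (clarCount G k : ℤ) * X ^ k

end ClarCovers

/-! ### Benzenoids as finite unions of hexagonal cells of the honeycomb lattice

The cell `(i, j)` is reached from the cell `(0, 0)` by `i` steps to the lower left neighbour and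
`j` steps to the lower right neighbour. In the plane, with the horizontal axis measured in units
of `√3` (so that the hexagons are regular, with two vertical edges and with sides of length `2`),
it is centred at `(j - i, -3 (i + j))`. -/

/-- The corners of a regular hexagon centred at the origin, in cyclic order, starting at the top. -/
def hexOffset : Fin 6 → ℤ × ℤ :=
  ![(0, 2), (1, 1), (1, -1), (0, -2), (-1, -1), (-1, 1)]

/-- The `t`-th corner of the cell `c`. -/
def hexCorner (c : ℤ × ℤ) (t : Fin 6) : ℤ × ℤ :=
  (c.2 - c.1, -3 * (c.1 + c.2)) + hexOffset t

/-- All corners of the cells in `S`. -/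
def benzenoidVertices (S : Finset (ℤ × ℤ)) : Finset (ℤ × ℤ) :=
  S.biUnion fun c => Finset.univ.image (hexCorner c)

/-- The graph formed by all corners and all sides of the hexagonal cells in `S`. -/
def benzenoid (S : Finset (ℤ × ℤ)) : SimpleGraph (benzenoidVertices S) :=
  SimpleGraph.fromRel fun p q =>
    ∃ c ∈ S, ∃ t : Fin 6, p.val = hexCorner c t ∧ q.val = hexCorner c (t + 1)

/-- The cells of the parallelogram with `n` cells in the lower left direction and `m` cells in the
lower right direction. -/
def parallelogramCells (m n : ℕ) : Finset (ℤ × ℤ) :=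
  Finset.Ico (0 : ℤ) n ×ˢ Finset.Ico (0 : ℤ) m

/-- The parallelogram `M(m, n)`. -/
def parallelogram (m n : ℕ) : SimpleGraph (benzenoidVertices (parallelogramCells m n)) :=
  benzenoid (parallelogramCells m n)

/-- The cells of the ribbon: an upper arm with `n₁ + n₂` cells in the lower left direction and
`m₁` cells in the lower right direction, and a lower arm with `n₁` cells in the lower left
direction and `m₁ + m₂` cells in the lower right direction; they overlap in an `m₁ × n₁`
parallelogram, at the lower left end of the upper arm and the upper left end of the lower arm. -/
def ribbonCells (n₁ n₂ m₁ m₂ : ℕ) : Finset (ℤ × ℤ) :=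
  Finset.Ico (0 : ℤ) (n₁ + n₂) ×ˢ Finset.Ico (0 : ℤ) m₁ ∪
    Finset.Ico (n₂ : ℤ) (n₁ + n₂) ×ˢ Finset.Ico (0 : ℤ) (m₁ + m₂)

/-- The ribbon `Rb(n₁, n₂, m₁, m₂)`. -/
def ribbon (n₁ n₂ m₁ m₂ : ℕ) : SimpleGraph (benzenoidVertices (ribbonCells n₁ n₂ m₁ m₂)) :=
  benzenoid (ribbonCells n₁ n₂ m₁ m₂)

/-- The ribbon `V(k₁, k₂, m, n)`, for `k₁ ≤ n` and `k₂ ≤ m`: the ribbon with `n₁ = k₁`, `m₁ = k₂`,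
`m = m₁ + m₂` and `n = n₁ + n₂`. -/
def ribbonV₂ (k₁ k₂ m n : ℕ) :
    SimpleGraph (benzenoidVertices (ribbonCells k₁ (n - k₁) k₂ (m - k₂))) :=
  ribbon k₁ (n - k₁) k₂ (m - k₂)

/-- The ribbon `V(k, m, n)`, for `k ≤ m` and `k ≤ n`: the ribbon with `n₁ = m₁ = k`,
`m = m₁ + m₂` and `n = n₁ + n₂`. -/
def ribbonV (k m n : ℕ) :
    SimpleGraph (benzenoidVertices (ribbonCells k (n - k) k (m - k))) :=
  ribbon k (n - k) k (m - k)

end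

/-!
Enter a region of the honeycomb lattice at its topmost vertex. This vertex has two neighbours, both
below it, and in a Clar cover it is bonded to the right one, bonded to the left one, or lies on the
hexagon between them. Remove that bond or hexagon. The vertical edge below it has then lost its
upper end, so its lower end has only two neighbours left, both below it, and the argument repeats.
This traces a lattice path from the top of the region to its bottom with steps `(0, 1)`, `(1, 0)`
and `(1, 1)`, where the diagonal steps, which carry the weight `X`, are the hexagons. The vertices
off the path are paired by the vertical edges, and no other cover of them is possible, so the Clar
covers correspond to the paths.

For a parallelogram these paths are counted by the weighted Delannoy numbers
`∑ j, (m choose j) (n choose j) (1 + X) ^ j`. For a ribbon, every path crosses the antidiagonal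
through the reentrant corner `(n₂, m₁)`, either at a lattice point, which gives the first sum of the
formula, or by a diagonal step that jumps over it, which gives the second sum, with its factor `X`.
-/

/-! ### Components as tiles -/

section Tiles

open SimpleGraph Set

variable {V κ κ' : Type*} {K : SimpleGraph κ} {K' : SimpleGraph κ'} {H H' : SimpleGraph V}
  {f : κ → V} {g : κ' → V} {u v w a : V}

/-- `f` is an isomorphism of the pattern `K` onto a union of connected components of `H`. For a
connected `K` this is a labelling of one component by `K`. -/
structure IsTile (K : SimpleGraph κ) (H : SimpleGraph V) (f : κ → V) : Prop where
  injective : Function.Injective f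
  adj_left_iff : ∀ t w, H.Adj (f t) w ↔ ∃ s, K.Adj t s ∧ f s = w

lemma adj_map_iff_of_injective (hf : Function.Injective f) :
    (K.map f).Adj v w ↔ ∃ s t, K.Adj s t ∧ f s = v ∧ f t = w :=
  map_adj ⟨f, hf⟩ K v w

lemma map_adj_apply_left_iff (hf : Function.Injective f) {t : κ} :
    (K.map f).Adj (f t) w ↔ ∃ s, K.Adj t s ∧ f s = w := by
  simp [adj_map_iff_of_injective hf, hf.eq_iff]

lemma mem_range_of_map_adj (h : (K.map f).Adj v w) : v ∈ range f := by
  obtain ⟨-, s, -, -, rfl, -⟩ := h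
  exact mem_range_self s

namespace IsTile

lemma adj_iff (h : IsTile K H f) {s t : κ} : H.Adj (f s) (f t) ↔ K.Adj s t := by
  simp [h.adj_left_iff, h.injective.eq_iff]

lemma mem_range_of_adj (h : IsTile K H f) (hv : v ∈ range f) (hvw : H.Adj v w) :
    w ∈ range f := by
  obtain ⟨t, rfl⟩ := hv
  obtain ⟨s, -, rfl⟩ := (h.adj_left_iff t w).1 hvw
  exact mem_range_self s

lemma range_eq_supp (h : IsTile K H f) (hK : K.Preconnected) (hv : v ∈ range f) :
    range f = (H.connectedComponentMk v).supp := by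
  obtain ⟨t, rfl⟩ := hv
  ext w
  rw [ConnectedComponent.mem_supp_iff, ConnectedComponent.eq]
  constructor
  · rintro ⟨s, rfl⟩
    exact (hK s t).map (⟨f, h.adj_iff.2⟩ : K →g H)
  · intro hw
    obtain ⟨p⟩ := hw.symm
    have mem_range_of_walk {a b : V} (q : H.Walk a b) : a ∈ range f → b ∈ range f := by
      induction q with
      | nil => exact id
      | cons hab _ ih => exact fun ha => ih (h.mem_range_of_adj ha hab)
    exact mem_range_of_walk p (mem_range_self t)

lemma range_eq_of_mem (hf : IsTile K H f) (hg : IsTile K' H g) (hK : K.Preconnected)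
    (hK' : K'.Preconnected) (hvf : v ∈ range f) (hvg : v ∈ range g) : range f = range g :=
  (hf.range_eq_supp hK hvf).trans (hg.range_eq_supp hK' hvg).symm

lemma comp_iso (h : IsTile K H f) (e : K ≃g K) : IsTile K H (f ∘ e) where
  injective := h.injective.comp e.injective
  adj_left_iff t w := by
    rw [Function.comp_apply, h.adj_left_iff, e.surjective.exists]
    simp [e.map_adj_iff]

lemma congr (h : IsTile K H f) (hadj : ∀ t w, H'.Adj (f t) w ↔ H.Adj (f t) w) :
    IsTile K H' f where
  injective := h.injective
  adj_left_iff t w := (hadj t w).trans (h.adj_left_iff t w)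

end IsTile

lemma nonempty_iso_iff_exists_isTile (c : H.ConnectedComponent) :
    Nonempty (c.toSimpleGraph ≃g K) ↔ ∃ f, IsTile K H f ∧ range f = c.supp := by
  constructor
  · rintro ⟨φ⟩
    refine ⟨fun t => (φ.symm t).1, ⟨Subtype.val_injective.comp φ.symm.injective, ?_⟩, ?_⟩
    · intro t w
      constructor
      · intro h
        have hw : w ∈ c.supp := c.mem_supp_of_adj_mem_supp (φ.symm t).2 h
        refine ⟨φ ⟨w, hw⟩, ?_, by simp⟩
        rwa [← φ.symm.map_adj_iff, φ.symm_apply_apply]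
      · rintro ⟨s, hs, rfl⟩
        exact φ.symm.map_adj_iff.2 hs
    · ext v
      exact ⟨fun ⟨t, ht⟩ => ht ▸ (φ.symm t).2, fun hv => ⟨φ ⟨v, hv⟩, by simp⟩⟩
  · rintro ⟨f, hf, hr⟩
    have hmem (t : κ) : f t ∈ c.supp := hr ▸ mem_range_self t
    let e : κ ≃ c := Equiv.ofBijective (fun t => (⟨f t, hmem t⟩ : c))
      ⟨fun s t hst => hf.injective (congrArg Subtype.val hst), fun ⟨v, hv⟩ => by
        obtain ⟨t, rfl⟩ : v ∈ range f := hr ▸ hv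
        exact ⟨t, rfl⟩⟩
    exact ⟨(RelIso.mk e hf.adj_iff : K ≃g c.toSimpleGraph).symm⟩

lemma nonempty_iso_mk_iff (hK : K.Preconnected) :
    Nonempty ((H.connectedComponentMk v).toSimpleGraph ≃g K) ↔
      ∃ f, IsTile K H f ∧ v ∈ range f := by
  rw [nonempty_iso_iff_exists_isTile]
  refine exists_congr fun f => and_congr_right fun hf => ⟨fun hr => ?_, hf.range_eq_supp hK⟩
  exact hr ▸ ConnectedComponent.connectedComponentMk_mem

lemma isDoubleBond_mk_iff : IsDoubleBond (H.connectedComponentMk v) ↔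
    ∃ f, IsTile (⊤ : SimpleGraph (Fin 2)) H f ∧ v ∈ range f :=
  nonempty_iso_mk_iff preconnected_top

lemma isSextet_mk_iff : IsSextet (H.connectedComponentMk v) ↔
    ∃ f, IsTile (cycleGraph 6) H f ∧ v ∈ range f :=
  nonempty_iso_mk_iff cycleGraph_preconnected

/-- The vertex sets of the hexagonal components of `H`: unlike the components themselves, they can
be compared for different graphs `H` on the same vertices. -/
def sextetSets (H : SimpleGraph V) : Set (Set V) :=
  {T | ∃ f, IsTile (cycleGraph 6) H f ∧ range f = T}

lemma clarOrder_eq_ncard_sextetSets (H : SimpleGraph V) :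
    clarOrder H = (sextetSets H).ncard := by
  rw [clarOrder, ← ncard_image_of_injective _ ConnectedComponent.supp_injective]
  congr 1
  ext T
  constructor
  · rintro ⟨c, hc, rfl⟩
    exact (nonempty_iso_iff_exists_isTile c).1 hc
  · rintro ⟨f, hf, rfl⟩
    have hr := hf.range_eq_supp cycleGraph_preconnected (mem_range_self 0)
    exact ⟨_, isSextet_mk_iff.2 ⟨f, hf, mem_range_self 0⟩, hr.symm⟩

/-! ### Removing and adding a tile -/

lemma isTile_sup_map (hf : Function.Injective f) (hH : ∀ t w, ¬ H.Adj (f t) w) :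
    IsTile K (H ⊔ K.map f) f where
  injective := hf
  adj_left_iff t w := by simp [map_adj_apply_left_iff hf, hH]

lemma disjoint_map_of_not_adj (hH : ∀ t w, ¬ H.Adj (f t) w) : Disjoint H (K.map f) := by
  rw [SimpleGraph.disjoint_left]
  intro v w hH' hK
  obtain ⟨t, rfl⟩ := mem_range_of_map_adj hK
  exact hH t w hH'

namespace IsTile

lemma map_le (h : IsTile K H f) : K.map f ≤ H := by
  intro v w hvw
  obtain ⟨s, t, hst, rfl, rfl⟩ := (adj_map_iff_of_injective h.injective).1 hvw
  exact h.adj_iff.2 hst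

lemma not_mem_range_of_sdiff_map_adj (h : IsTile K H f) (hvw : (H \ K.map f).Adj v w) :
    v ∉ range f := by
  rintro ⟨t, rfl⟩
  rw [sdiff_adj, map_adj_apply_left_iff h.injective, h.adj_left_iff] at hvw
  exact hvw.2 hvw.1

lemma sdiff_map_iff (hf : IsTile K H f) (hK : K.Preconnected) (hK' : K'.Preconnected)
    [Nontrivial κ'] : IsTile K' (H \ K.map f) g ↔ IsTile K' H g ∧ range g ≠ range f := by
  have adj_iff_of_not_mem {v w : V} (hv : v ∉ range f) :
      (H \ K.map f).Adj v w ↔ H.Adj v w := by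
    simp [sdiff_adj, mt mem_range_of_map_adj hv]
  constructor
  · intro hg
    have not_mem (t : κ') : g t ∉ range f := by
      obtain ⟨s, hs⟩ := hK'.exists_adj_of_nontrivial t
      exact hf.not_mem_range_of_sdiff_map_adj (hg.adj_iff.2 hs)
    obtain ⟨t⟩ := (inferInstance : Nonempty κ')
    exact ⟨hg.congr fun t w => (adj_iff_of_not_mem (not_mem t)).symm,
      fun h => not_mem t (h ▸ mem_range_self t)⟩
  · rintro ⟨hg, hne⟩
    refine hg.congr fun t w => adj_iff_of_not_mem fun ht => hne ?_
    exact hg.range_eq_of_mem hf hK' hK (mem_range_self t) ht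

lemma exists_sdiff_map_iff (hf : IsTile K H f) (hK : K.Preconnected) (hK' : K'.Preconnected)
    [Nontrivial κ'] (hv : v ∉ range f) :
    (∃ g, IsTile K' (H \ K.map f) g ∧ v ∈ range g) ↔ ∃ g, IsTile K' H g ∧ v ∈ range g := by
  refine exists_congr fun g => and_congr_left fun hvg => ?_
  rw [hf.sdiff_map_iff hK hK', and_iff_left]
  exact fun h => hv (h ▸ hvg)

lemma sextetSets_sdiff_map (hf : IsTile K H f) (hK : K.Preconnected) :
    sextetSets (H \ K.map f) = sextetSets H \ {range f} := by
  ext T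
  simp only [sextetSets, mem_sdiff, mem_ofPred_eq, mem_singleton_iff,
    hf.sdiff_map_iff hK cycleGraph_preconnected]
  constructor
  · rintro ⟨g, ⟨hg, hne⟩, rfl⟩
    exact ⟨⟨g, hg, rfl⟩, hne⟩
  · rintro ⟨⟨g, hg, rfl⟩, hne⟩
    exact ⟨g, ⟨hg, hne⟩, rfl⟩

end IsTile

/-! ### Partial Clar covers -/

/-- A Clar cover of the subgraph of `G` induced on `W`. It is encoded as a graph on all vertices of
`G`, in which the vertices outside `W` are isolated. -/
structure IsPartialClarCover (G : SimpleGraph V) (W : Set V) (H : SimpleGraph V) : Prop where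
  le : H ≤ G
  mem_of_adj : ∀ {v w}, H.Adj v w → v ∈ W
  isDoubleBond_or_isSextet : ∀ v ∈ W,
    IsDoubleBond (H.connectedComponentMk v) ∨ IsSextet (H.connectedComponentMk v)

variable {G : SimpleGraph V} {W : Set V}

lemma isPartialClarCover_univ_iff : IsPartialClarCover G univ H ↔ IsClarCover G H :=
  ⟨fun h => ⟨h.le, ConnectedComponent.ind fun v => h.isDoubleBond_or_isSextet v (mem_univ v)⟩,
    fun h => ⟨h.1, fun _ => mem_univ _, fun _ _ => h.2 _⟩⟩

lemma IsTile.isPartialClarCover_sdiff_map_iff (hf : IsTile K H f) (hK : K.Preconnected)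
    (hfG : K.map f ≤ G) (hfW : range f ⊆ W)
    (hcomp : ∀ t, IsDoubleBond (H.connectedComponentMk (f t)) ∨
      IsSextet (H.connectedComponentMk (f t))) :
    IsPartialClarCover G (W \ range f) (H \ K.map f) ↔ IsPartialClarCover G W H := by
  have component_iff {v : V} (hv : v ∉ range f) :
      IsDoubleBond ((H \ K.map f).connectedComponentMk v) ∨
        IsSextet ((H \ K.map f).connectedComponentMk v) ↔
      IsDoubleBond (H.connectedComponentMk v) ∨ IsSextet (H.connectedComponentMk v) := by
    simp only [isDoubleBond_mk_iff, isSextet_mk_iff,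
      hf.exists_sdiff_map_iff hK preconnected_top hv,
      hf.exists_sdiff_map_iff hK cycleGraph_preconnected hv]
  constructor
  · intro h
    refine ⟨?_, fun {v w} hvw => ?_, fun v hv => ?_⟩
    · rw [← sdiff_sup_cancel hf.map_le]
      exact sup_le h.le hfG
    · by_cases hmap : (K.map f).Adj v w
      · exact hfW (mem_range_of_map_adj hmap)
      · exact (h.mem_of_adj ((sdiff_adj _ _ _ _).2 ⟨hvw, hmap⟩)).1
    · by_cases hvf : v ∈ range f
      · obtain ⟨t, rfl⟩ := hvf
        exact hcomp t
      · exact (component_iff hvf).1 (h.isDoubleBond_or_isSextet v ⟨hv, hvf⟩)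
  · intro h
    refine ⟨sdiff_le.trans h.le, fun hvw => ?_, fun v hv => ?_⟩
    · exact ⟨h.mem_of_adj hvw.1, hf.not_mem_range_of_sdiff_map_adj hvw⟩
    · exact (component_iff hv.2).2 (h.isDoubleBond_or_isSextet v hv.1)

section CoverPoly

variable [Finite V]

/-- The set of Clar covers of the subgraph of `G` induced on `W`. -/
noncomputable def partialClarCovers (G : SimpleGraph V) (W : Set V) : Finset (SimpleGraph V) :=
  (toFinite {H | IsPartialClarCover G W H}).toFinset

/-- The Zhang–Zhang polynomial of the subgraph of `G` induced on `W`, as a sum over its Clar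
covers. -/
noncomputable def coverPoly (G : SimpleGraph V) (W : Set V) : ℤ[X] :=
  ∑ H ∈ partialClarCovers G W, X ^ clarOrder H

lemma mem_partialClarCovers : H ∈ partialClarCovers G W ↔ IsPartialClarCover G W H := by
  simp [partialClarCovers]

lemma coverPoly_univ (G : SimpleGraph V) : coverPoly G univ = ZZ G := by
  classical
  have clarOrder_le {H : SimpleGraph V} (hH : IsClarCover G H) : clarOrder H ≤ clarNumber G := by
    refine le_csSup (Finite.bddAbove ?_) ⟨H, hH, rfl⟩
    exact ((toFinite {H | IsClarCover G H}).image clarOrder).subset fun k hk => hk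
  rw [coverPoly, ZZ, ← Finset.sum_fiberwise_of_maps_to (g := clarOrder)
    (t := Finset.range (clarNumber G + 1))]
  · refine Finset.sum_congr rfl fun k _ => ?_
    have hcount :
        clarCount G k = ((partialClarCovers G univ).filter fun H => clarOrder H = k).card := by
      rw [clarCount, ← ncard_coe_finset]
      congr 1
      ext H
      simp [mem_partialClarCovers, isPartialClarCover_univ_iff]
    rw [Finset.sum_congr rfl (g := fun _ => X ^ k) fun H hH => by rw [(Finset.mem_filter.1 hH).2],
      Finset.sum_const, hcount]
    simp
  · intro H hH
    rw [mem_partialClarCovers, isPartialClarCover_univ_iff] at hH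
    exact Finset.mem_range_succ_iff.2 (clarOrder_le hH)

lemma clarOrder_bot : clarOrder (⊥ : SimpleGraph V) = 0 := by
  rw [clarOrder_eq_ncard_sextetSets, ncard_eq_zero, eq_empty_iff_forall_notMem]
  rintro _ ⟨f, hf, -⟩
  obtain ⟨t, ht⟩ := cycleGraph_preconnected.exists_adj_of_nontrivial (0 : Fin 6)
  exact hf.adj_iff.2 ht

lemma coverPoly_empty (G : SimpleGraph V) : coverPoly G ∅ = 1 := by
  have h : partialClarCovers G ∅ = {⊥} := by
    ext H
    rw [mem_partialClarCovers, Finset.mem_singleton]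
    constructor
    · exact fun h => eq_bot_iff.2 fun v w hvw => h.mem_of_adj hvw
    · rintro rfl
      exact ⟨bot_le, False.elim, fun v hv => hv.elim⟩
  rw [coverPoly, h, Finset.sum_singleton, clarOrder_bot, pow_zero]

open Classical in
lemma sum_filter_isTile (hf : Function.Injective f) (hK : K.Preconnected) (hfG : K.map f ≤ G)
    (hfW : range f ⊆ W) {e : ℕ}
    (hcomp : ∀ H : SimpleGraph V, IsTile K H f → ∀ t, IsDoubleBond (H.connectedComponentMk (f t)) ∨
      IsSextet (H.connectedComponentMk (f t)))
    (horder : ∀ H : SimpleGraph V, IsTile K H f →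
      clarOrder H = e + clarOrder (H \ K.map f)) :
    ∑ H ∈ partialClarCovers G W with IsTile K H f, X ^ clarOrder H =
      (X ^ e * coverPoly G (W \ range f) : ℤ[X]) := by
  rw [coverPoly, Finset.mul_sum]
  have not_adj {H : SimpleGraph V} (hH : H ∈ partialClarCovers G (W \ range f)) (t : κ) (w : V) :
      ¬ H.Adj (f t) w :=
    fun h => ((mem_partialClarCovers.1 hH).mem_of_adj h).2 (mem_range_self t)
  refine Finset.sum_nbij' (· \ K.map f) (· ⊔ K.map f) ?_ ?_ ?_ ?_ ?_
  · intro H hH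
    rw [Finset.mem_filter, mem_partialClarCovers] at hH
    exact mem_partialClarCovers.2 <|
      (hH.2.isPartialClarCover_sdiff_map_iff hK hfG hfW (hcomp H hH.2)).2 hH.1
  · intro H hH
    have hT := isTile_sup_map (K := K) hf (not_adj hH)
    rw [Finset.mem_filter, mem_partialClarCovers,
      ← hT.isPartialClarCover_sdiff_map_iff hK hfG hfW (hcomp _ hT),
      (disjoint_map_of_not_adj (not_adj hH)).sup_sdiff_cancel_right]
    exact ⟨mem_partialClarCovers.1 hH, hT⟩
  · exact fun H hH => sdiff_sup_cancel (Finset.mem_filter.1 hH).2.map_le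
  · exact fun H hH => (disjoint_map_of_not_adj (not_adj hH)).sup_sdiff_cancel_right
  · intro H hH
    rw [horder H (Finset.mem_filter.1 hH).2, pow_add]

open Classical in
lemma sum_filter_bond (hu : u ∈ W) (ha : a ∈ W) (hua : G.Adj u a) :
    ∑ H ∈ partialClarCovers G W with IsTile (⊤ : SimpleGraph (Fin 2)) H ![u, a],
      X ^ clarOrder H = coverPoly G (W \ {u, a}) := by
  have hr : range ![u, a] = {u, a} := by simp [pair_comm]
  have hinj : Function.Injective ![u, a] := by
    simpa [Function.Injective, Fin.forall_fin_two] using ⟨hua.ne, hua.ne'⟩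
  rw [sum_filter_isTile hinj preconnected_top (e := 0), hr, pow_zero, one_mul]
  · refine (map_le_iff_le_comap ⟨_, hinj⟩ _ _).2 ?_
    intro s t
    fin_cases s <;> fin_cases t <;> simp [hua, hua.symm]
  · simp [hr, insert_subset_iff, hu, ha]
  · exact fun H h t => Or.inl (isDoubleBond_mk_iff.2 ⟨_, h, mem_range_self t⟩)
  · intro H h
    have not_sextet : range ![u, a] ∉ sextetSets H := by
      rintro ⟨g, hg, hgr⟩
      have := ncard_range_of_injective hg.injective
      rw [hgr, ncard_range_of_injective hinj] at this
      simp at this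
    rw [zero_add, clarOrder_eq_ncard_sextetSets, clarOrder_eq_ncard_sextetSets,
      h.sextetSets_sdiff_map preconnected_top, sdiff_singleton_eq_self not_sextet]

open Classical in
lemma sum_filter_hexagon {f : Fin 6 → V} (hf : Function.Injective f) (hfW : ∀ t, f t ∈ W)
    (hfG : ∀ t, G.Adj (f t) (f (t + 1))) :
    ∑ H ∈ partialClarCovers G W with IsTile (cycleGraph 6) H f, X ^ clarOrder H =
      X * coverPoly G (W \ range f) := by
  rw [sum_filter_isTile hf cycleGraph_preconnected (e := 1), pow_one]
  · refine (map_le_iff_le_comap ⟨_, hf⟩ _ _).2 ?_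
    intro s t hst
    rcases cycleGraph_adj.1 hst with h | h
    · rw [← sub_add_cancel s t, h, add_comm]
      exact (hfG t).symm
    · rw [← sub_add_cancel t s, h, add_comm]
      exact hfG s
  · exact range_subset_iff.2 hfW
  · exact fun H h t => Or.inr (isSextet_mk_iff.2 ⟨_, h, mem_range_self t⟩)
  · intro H h
    rw [clarOrder_eq_ncard_sextetSets, clarOrder_eq_ncard_sextetSets,
      h.sextetSets_sdiff_map cycleGraph_preconnected, add_comm,
      ncard_sdiff_singleton_add_one (s := sextetSets H) ⟨f, h, rfl⟩]

end CoverPoly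

/-! ### Covering a vertex with one or two neighbours -/

/-- Rotation of a cycle by `t`. -/
def cycleGraphRotate {n : ℕ} (t : Fin (n + 2)) : cycleGraph (n + 2) ≃g cycleGraph (n + 2) where
  toEquiv := Equiv.addRight t
  map_rel_iff' := by simp [cycleGraph_adj]

/-- The reflection of a cycle fixing the vertex `0`. -/
def cycleGraphReflect {n : ℕ} : cycleGraph (n + 2) ≃g cycleGraph (n + 2) where
  toEquiv := Equiv.neg _
  map_rel_iff' := by simp [cycleGraph_adj, or_comm, add_comm, sub_eq_add_neg]

lemma IsTile.exists_apply_zero {n : ℕ} {f : Fin (n + 2) → V}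
    (h : IsTile (cycleGraph (n + 2)) H f) (hu : u ∈ range f) :
    ∃ g, IsTile (cycleGraph (n + 2)) H g ∧ g 0 = u := by
  obtain ⟨t, rfl⟩ := hu
  exact ⟨_, h.comp_iso (cycleGraphRotate t), by simp [cycleGraphRotate]⟩

lemma IsTile.cycle_adj {n : ℕ} {f : Fin (n + 2) → V} (h : IsTile (cycleGraph (n + 2)) H f)
    (t : Fin (n + 2)) : H.Adj (f t) (f (t + 1)) :=
  h.adj_iff.2 (cycleGraph_adj.2 (Or.inr (by simp)))

lemma IsTile.bond_adj_iff (h : IsTile (⊤ : SimpleGraph (Fin 2)) H ![u, a]) :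
    H.Adj u w ↔ w = a := by
  simpa [Fin.exists_fin_two, eq_comm] using h.adj_left_iff 0 w

lemma IsPartialClarCover.exists_bond_or_hexagon (hH : IsPartialClarCover G W H) (hu : u ∈ W) :
    (∃ a, IsTile (⊤ : SimpleGraph (Fin 2)) H ![u, a]) ∨
      ∃ g, IsTile (cycleGraph 6) H g ∧ g 0 = u := by
  refine (hH.isDoubleBond_or_isSextet u hu).imp (fun h => ?_) (fun h => ?_)
  · obtain ⟨f, hf, huf⟩ := isDoubleBond_mk_iff.1 h
    rw [← cycleGraph_two_eq_top] at hf
    obtain ⟨g, hg, rfl⟩ := hf.exists_apply_zero huf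
    refine ⟨g 1, ?_⟩
    rw [← cycleGraph_two_eq_top]
    convert hg
    ext t
    fin_cases t <;> rfl
  · obtain ⟨f, hf, huf⟩ := isSextet_mk_iff.1 h
    exact hf.exists_apply_zero huf

lemma IsPartialClarCover.isTile_of_unique_neighbor (hH : IsPartialClarCover G W H) (hu : u ∈ W)
    (hnbr : ∀ w ∈ W, G.Adj u w → w = a) : IsTile (⊤ : SimpleGraph (Fin 2)) H ![u, a] := by
  have eq_of_adj {w : V} (hw : H.Adj u w) : w = a := hnbr w (hH.mem_of_adj hw.symm) (hH.le hw)
  obtain ⟨b, hb⟩ | ⟨g, hg, rfl⟩ := hH.exists_bond_or_hexagon hu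
  · rwa [← eq_of_adj (hb.bond_adj_iff.2 rfl)]
  · have h := (eq_of_adj (hg.cycle_adj 0)).trans (eq_of_adj (hg.cycle_adj 5).symm).symm
    exact absurd (hg.injective h) (by decide)

lemma IsPartialClarCover.isTile_of_two_neighbors {f : Fin 6 → V} (hH : IsPartialClarCover G W H)
    (hf : f 0 ∈ W) (hnbr : ∀ w ∈ W, G.Adj (f 0) w → w = f 1 ∨ w = f 5)
    (huniq : ∀ g : Fin 6 → V, Function.Injective g → (∀ t, G.Adj (g t) (g (t + 1))) →
      g 0 = f 0 → g 1 = f 1 → g 5 = f 5 → g = f) :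
    IsTile (⊤ : SimpleGraph (Fin 2)) H ![f 0, f 1] ∨
      IsTile (⊤ : SimpleGraph (Fin 2)) H ![f 0, f 5] ∨ IsTile (cycleGraph 6) H f := by
  have eq_of_adj {w : V} (hw : H.Adj (f 0) w) : w = f 1 ∨ w = f 5 :=
    hnbr w (hH.mem_of_adj hw.symm) (hH.le hw)
  obtain ⟨b, hb⟩ | ⟨g, hg, h0⟩ := hH.exists_bond_or_hexagon hf
  · obtain rfl | rfl := eq_of_adj (hb.bond_adj_iff.2 rfl)
    exacts [Or.inl hb, Or.inr (Or.inl hb)]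
  · have eq_f {g : Fin 6 → V} (hg : IsTile (cycleGraph 6) H g) (h0 : g 0 = f 0) (h1 : g 1 = f 1)
        (h5 : g 5 = f 5) : g = f :=
      huniq g hg.injective (fun t => hH.le (hg.cycle_adj t)) h0 h1 h5
    have h15 : g 1 ≠ g 5 := hg.injective.ne (by decide)
    have hg1 : g 1 = f 1 ∨ g 1 = f 5 := eq_of_adj (h0 ▸ hg.cycle_adj 0)
    have hg5 : g 5 = f 1 ∨ g 5 = f 5 := eq_of_adj (h0 ▸ (hg.cycle_adj 5).symm)
    right; right
    rcases hg1 with h1 | h1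
    · rw [← eq_f hg h0 h1 (hg5.resolve_left fun h => h15 (h1.trans h.symm))]
      exact hg
    · have hg' := hg.comp_iso cycleGraphReflect
      rw [← eq_f hg' h0 (hg5.resolve_right fun h => h15 (h1.trans h.symm)) h1]
      exact hg'

variable [Finite V]

lemma coverPoly_of_unique_neighbor (hu : u ∈ W) (ha : a ∈ W) (hua : G.Adj u a)
    (hnbr : ∀ w ∈ W, G.Adj u w → w = a) : coverPoly G W = coverPoly G (W \ {u, a}) := by
  classical
  rw [← sum_filter_bond hu ha hua, coverPoly, Finset.filter_true_of_mem]
  exact fun H hH => (mem_partialClarCovers.1 hH).isTile_of_unique_neighbor hu hnbr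

lemma coverPoly_of_two_neighbors {f : Fin 6 → V} (hf : Function.Injective f)
    (hfW : ∀ t, f t ∈ W) (hfG : ∀ t, G.Adj (f t) (f (t + 1)))
    (hnbr : ∀ w ∈ W, G.Adj (f 0) w → w = f 1 ∨ w = f 5)
    (huniq : ∀ g : Fin 6 → V, Function.Injective g → (∀ t, G.Adj (g t) (g (t + 1))) →
      g 0 = f 0 → g 1 = f 1 → g 5 = f 5 → g = f) :
    coverPoly G W = coverPoly G (W \ {f 0, f 1}) + coverPoly G (W \ {f 0, f 5}) +
      X * coverPoly G (W \ range f) := by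
  classical
  rw [← sum_filter_bond (hfW 0) (hfW 1) (hfG 0), ← sum_filter_bond (hfW 0) (hfW 5) (hfG 5).symm,
    ← sum_filter_hexagon hf hfW hfG, Finset.sum_filter, Finset.sum_filter, Finset.sum_filter,
    ← Finset.sum_add_distrib, ← Finset.sum_add_distrib, coverPoly]
  refine Finset.sum_congr rfl fun H hH => ?_
  have h15 : f 1 ≠ f 5 := hf.ne (by decide)
  have not_bond (h₁ : IsTile (⊤ : SimpleGraph (Fin 2)) H ![f 0, f 1]) :
      ¬ IsTile (⊤ : SimpleGraph (Fin 2)) H ![f 0, f 5] :=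
    fun h₅ => h15 (h₅.bond_adj_iff.1 (h₁.bond_adj_iff.2 rfl))
  have not_bond_one (h : IsTile (cycleGraph 6) H f) :
      ¬ IsTile (⊤ : SimpleGraph (Fin 2)) H ![f 0, f 1] :=
    fun h₁ => h15 (h₁.bond_adj_iff.1 (h.cycle_adj 5).symm).symm
  have not_bond_five (h : IsTile (cycleGraph 6) H f) :
      ¬ IsTile (⊤ : SimpleGraph (Fin 2)) H ![f 0, f 5] :=
    fun h₅ => h15 (h₅.bond_adj_iff.1 (h.cycle_adj 0))
  obtain h | h | h :=
    (mem_partialClarCovers.1 hH).isTile_of_two_neighbors (hfW 0) hnbr huniq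
  · simp [h, not_bond h, mt not_bond_one (not_not_intro h)]
  · simp [h, mt not_bond (not_not_intro h), mt not_bond_five (not_not_intro h)]
  · simp [h, not_bond_one h, not_bond_five h]

end Tiles
/-! ### Delannoy polynomials -/

section Delannoy

/-- The Delannoy polynomial. By its recurrence `delannoy_succ_succ`, the coefficient of `X ^ d`
counts the lattice paths from `(0, 0)` to `(m, n)` with steps `(1, 0)`, `(0, 1)` and `(1, 1)` that
have `d` diagonal steps; the definition is the closed form in powers of `1 + X`. -/
noncomputable def delannoy (m n : ℕ) : ℤ[X] :=
  ∑ j ∈ Finset.Icc 0 (min m n), (m.choose j * n.choose j : ℤ[X]) * (1 + X) ^ j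

lemma delannoy_eq_sum_of_le {m n B : ℕ} (hB : m ≤ B ∨ n ≤ B) :
    delannoy m n =
      ∑ j ∈ Finset.Icc 0 B, (m.choose j * n.choose j : ℤ[X]) * (1 + X) ^ j := by
  refine Finset.sum_subset (Finset.Icc_subset_Icc_right (min_le_iff.2 hB)) fun j _ hj => ?_
  simp only [Finset.mem_Icc, zero_le, true_and, le_min_iff, not_and_or, not_le] at hj
  rcases hj with h | h
  all_goals simp [Nat.choose_eq_zero_of_lt h]

lemma delannoy_comm (m n : ℕ) : delannoy m n = delannoy n m := by
  simp only [delannoy, min_comm m n, mul_comm (m.choose _ : ℤ[X])]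

@[simp] lemma delannoy_zero_left (n : ℕ) : delannoy 0 n = 1 := by simp [delannoy]

@[simp] lemma delannoy_zero_right (m : ℕ) : delannoy m 0 = 1 := by simp [delannoy]

lemma delannoy_succ_succ (m n : ℕ) :
    delannoy (m + 1) (n + 1) = delannoy m (n + 1) + delannoy (m + 1) n + X * delannoy m n := by
  let term (m n j : ℕ) : ℤ[X] := (m.choose j * n.choose j : ℤ[X]) * (1 + X) ^ j
  have sum_eq {m' n' : ℕ} (h : m' ≤ m + 1) : delannoy m' n' =
      ∑ j ∈ Finset.range (m + 1), term m' n' (j + 1) + 1 := by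
    rw [delannoy_eq_sum_of_le (Or.inl h), ← Nat.range_succ_eq_Icc_zero, Finset.sum_range_succ']
    simp [term]
  have sum_mul : (1 + X) * delannoy m n = ∑ j ∈ Finset.range (m + 1), (1 + X) * term m n j := by
    rw [delannoy_eq_sum_of_le (Or.inl le_rfl), ← Nat.range_succ_eq_Icc_zero, Finset.mul_sum]
  have term_succ (j : ℕ) : term (m + 1) (n + 1) (j + 1) =
      term m (n + 1) (j + 1) + term (m + 1) n (j + 1) - term m n (j + 1) +
        (1 + X) * term m n j := by
    simp only [term, Nat.choose_succ_succ, Nat.cast_add]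
    ring
  have split : X * delannoy m n = (1 + X) * delannoy m n - delannoy m n := by ring
  rw [split, sum_mul, sum_eq (n' := n) (m.le_succ), sum_eq (m.le_succ), sum_eq le_rfl,
    sum_eq le_rfl]
  simp only [term_succ, Finset.sum_add_distrib, Finset.sum_sub_distrib]
  ring

lemma delannoy_mul_delannoy (a b c d : ℕ) :
    delannoy a b * delannoy c d =
      ∑ j ∈ Finset.Icc 0 a, ∑ i ∈ Finset.Icc 0 d,
        (a.choose j * b.choose j * c.choose i * d.choose i : ℤ[X]) * (1 + X) ^ (i + j) := by
  rw [delannoy_eq_sum_of_le (Or.inl le_rfl), delannoy_eq_sum_of_le (Or.inr le_rfl),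
    Finset.sum_mul_sum]
  refine Finset.sum_congr rfl fun j _ => Finset.sum_congr rfl fun i _ => ?_
  ring

lemma ascPochhammer_eval_neg_natCast {R : Type*} [CommRing R] (m j : ℕ) :
    (ascPochhammer R j).eval (-(m : R)) = (-1) ^ j * (j.factorial * m.choose j) := by
  rw [ascPochhammer_eval_neg_eq_descPochhammer, descPochhammer_eval_eq_descFactorial,
    Nat.descFactorial_eq_factorial_mul_choose, Nat.cast_mul]

lemma aeval_delannoy {K : Type*} [Field K] [CharZero K] [TopologicalSpace K]
    [IsTopologicalRing K] [T2Space K] (m n : ℕ) (x : K) :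
    aeval x (delannoy m n) = ₂F₁ (-m : K) (-n : K) (1 : K) (1 + x) := by
  simp only [ordinaryHypergeometric_eq_tsum]
  rw [tsum_eq_sum (s := Finset.Icc 0 (min m n)), delannoy, map_sum]
  · refine Finset.sum_congr rfl fun j _ => ?_
    have factorial_ne_zero : (j.factorial : K) ≠ 0 := Nat.cast_ne_zero.2 j.factorial_ne_zero
    have sign_mul_sign : (-1 : K) ^ j * (-1) ^ j = 1 := by rw [← mul_pow]; simp
    simp only [ascPochhammer_eval_neg_natCast, ascPochhammer_eval_one, map_mul, map_natCast,
      map_pow, map_add, map_one, aeval_X, smul_eq_mul]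
    field_simp
    linear_combination (-(m.choose j : K) * n.choose j * (1 + x) ^ j) * sign_mul_sign
  · intro j hj
    simp only [Finset.mem_Icc, zero_le, true_and, le_min_iff, not_and_or, not_le] at hj
    rcases hj with h | h
    all_goals simp [ascPochhammer_eval_neg_natCast, Nat.choose_eq_zero_of_lt h]

/-- Delannoy polynomials extended by zero to integer arguments, so that the recurrence needs no
boundary cases. -/
noncomputable def delannoyInt (a b : ℤ) : ℤ[X] :=
  if 0 ≤ a ∧ 0 ≤ b then delannoy a.toNat b.toNat else 0

@[simp] lemma delannoyInt_natCast (m n : ℕ) : delannoyInt m n = delannoy m n := by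
  simp [delannoyInt]

lemma delannoyInt_eq_zero {a b : ℤ} (h : a < 0 ∨ b < 0) : delannoyInt a b = 0 :=
  if_neg (by omega)

@[simp] lemma delannoyInt_zero_zero : delannoyInt 0 0 = 1 := by simp [delannoyInt]

lemma delannoyInt_zero_left {b : ℤ} (hb : 0 ≤ b) : delannoyInt 0 b = 1 := by
  simp [delannoyInt, hb]

lemma delannoyInt_zero_right {a : ℤ} (ha : 0 ≤ a) : delannoyInt a 0 = 1 := by
  simp [delannoyInt, ha]

lemma delannoyInt_rec_of_pos {a b : ℤ} (ha : 0 < a) (hb : 0 < b) :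
    delannoyInt a b = delannoyInt (a - 1) b + delannoyInt a (b - 1) +
      X * delannoyInt (a - 1) (b - 1) := by
  obtain ⟨m, rfl⟩ : ∃ m : ℕ, a = (m + 1 : ℕ) := ⟨(a - 1).toNat, by omega⟩
  obtain ⟨n, rfl⟩ : ∃ n : ℕ, b = (n + 1 : ℕ) := ⟨(b - 1).toNat, by omega⟩
  have sub_one (k : ℕ) : ((k + 1 : ℕ) : ℤ) - 1 = k := by simp
  simp only [sub_one, delannoyInt_natCast, delannoy_succ_succ]

lemma delannoyInt_rec (a b : ℤ) :
    delannoyInt a b = delannoyInt (a - 1) b + delannoyInt a (b - 1) +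
      X * delannoyInt (a - 1) (b - 1) + if a = 0 ∧ b = 0 then 1 else 0 := by
  by_cases h : a < 0 ∨ b < 0
  · rw [delannoyInt_eq_zero h, delannoyInt_eq_zero (by omega), delannoyInt_eq_zero (by omega),
      delannoyInt_eq_zero (by omega), if_neg (by omega)]
    simp
  obtain ⟨ha, hb⟩ : 0 ≤ a ∧ 0 ≤ b := by omega
  rcases ha.eq_or_lt with rfl | ha
  · rcases hb.eq_or_lt with rfl | hb
    · simp [delannoyInt_eq_zero]
    · simp [delannoyInt_eq_zero, delannoyInt_zero_left hb.le,
        delannoyInt_zero_left (b := b - 1) (by omega), hb.ne']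
  · rcases hb.eq_or_lt with rfl | hb
    · simp [delannoyInt_eq_zero, delannoyInt_zero_right ha.le,
        delannoyInt_zero_right (a := a - 1) (by omega), ha.ne']
    · rw [delannoyInt_rec_of_pos ha hb, if_neg (by omega), add_zero]

lemma sum_delannoyInt_mul_rec {ι : Type*} (s : Finset ι) (a b : ι → ℤ) (w : ι → ℤ[X]) (i j : ℤ) :
    ∑ k ∈ s, delannoyInt (a k - j) (b k - i) * w k =
      ∑ k ∈ s, delannoyInt (a k - (j + 1)) (b k - i) * w k +
      ∑ k ∈ s, delannoyInt (a k - j) (b k - (i + 1)) * w k +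
      X * ∑ k ∈ s, delannoyInt (a k - (j + 1)) (b k - (i + 1)) * w k +
      ∑ k ∈ s, if a k = j ∧ b k = i then w k else 0 := by
  rw [Finset.mul_sum, ← Finset.sum_add_distrib, ← Finset.sum_add_distrib,
    ← Finset.sum_add_distrib]
  refine Finset.sum_congr rfl fun k _ => ?_
  rw [delannoyInt_rec]
  simp only [sub_sub, sub_eq_zero]
  split_ifs <;> ring

end Delannoy

/-! ### Lattice paths in an L-shaped region -/

section PathSum

variable (n₁ n₂ m₁ m₂ : ℕ)

/-- The weighted number of lattice paths from `(i, j)` to `(n₁ + n₂, m₁ + m₂)` in the L-shaped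
region, for `(i, j)` before the antidiagonal `i + j = n₂ + m₁` through the reentrant corner. The
first sum is over the points `(n₂ + k, m₁ - k)` of the antidiagonal, the second over the diagonal
steps from `(n₂ + k - 1, m₁ - k)` to `(n₂ + k, m₁ - k + 1)` across it. -/
noncomputable def crossingSum (i j : ℤ) : ℤ[X] :=
  ∑ k ∈ Finset.Icc 0 (min n₁ m₁),
    delannoyInt (m₁ - k - j) (n₂ + k - i) * delannoy (m₂ + k) (n₁ - k) +
  X * ∑ k ∈ Finset.Icc 1 (min n₁ m₁),
    delannoyInt (m₁ - k - j) (n₂ + k - 1 - i) * delannoy (m₂ + k - 1) (n₁ - k)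

/-- The weighted number of lattice paths from `(i, j)` to `(n₁ + n₂, m₁ + m₂)` with steps `(0, 1)`
and `(1, 0)` of weight `1` and `(1, 1)` of weight `X`, in the L-shaped region covered by the cells
of the ribbon. -/
noncomputable def pathSum (i j : ℤ) : ℤ[X] :=
  if n₂ + m₁ ≤ i + j then delannoyInt (m₁ + m₂ - j) (n₁ + n₂ - i) else crossingSum n₁ n₂ m₁ m₂ i j

variable {n₁ n₂ m₁ m₂} {i j : ℤ}

lemma crossingSum_rec (h : i + j < n₂ + m₁) :
    crossingSum n₁ n₂ m₁ m₂ i j =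
      crossingSum n₁ n₂ m₁ m₂ i (j + 1) + crossingSum n₁ n₂ m₁ m₂ (i + 1) j +
      X * (crossingSum n₁ n₂ m₁ m₂ (i + 1) (j + 1) + ∑ k ∈ Finset.Icc 1 (min n₁ m₁),
        if (m₁ - k : ℤ) = j ∧ (n₂ + k - 1 : ℤ) = i then delannoy (m₂ + k - 1) (n₁ - k) else 0) := by
  have no_start_on_antidiagonal : ∑ k ∈ Finset.Icc 0 (min n₁ m₁),
      (if (m₁ - k : ℤ) = j ∧ (n₂ + k : ℤ) = i then delannoy (m₂ + k) (n₁ - k) else 0) = 0 :=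
    Finset.sum_eq_zero fun k _ => if_neg (by omega)
  rw [crossingSum,
    sum_delannoyInt_mul_rec _ (fun k : ℕ => (m₁ - k : ℤ)) (fun k : ℕ => (n₂ + k : ℤ)),
    sum_delannoyInt_mul_rec _ (fun k : ℕ => (m₁ - k : ℤ)) (fun k : ℕ => (n₂ + k - 1 : ℤ)),
    no_start_on_antidiagonal]
  simp only [crossingSum]
  ring

lemma crossingSum_rec_of_add_one_lt (h : i + j + 1 < n₂ + m₁) :
    crossingSum n₁ n₂ m₁ m₂ i j =
      crossingSum n₁ n₂ m₁ m₂ i (j + 1) + crossingSum n₁ n₂ m₁ m₂ (i + 1) j +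
      X * crossingSum n₁ n₂ m₁ m₂ (i + 1) (j + 1) := by
  rw [crossingSum_rec (by omega), Finset.sum_eq_zero, add_zero]
  exact fun k _ => if_neg (by omega)

lemma crossingSum_eq_zero (h : n₁ + n₂ < i ∨ m₁ < j ∨ n₂ + m₁ < i + j) :
    crossingSum n₁ n₂ m₁ m₂ i j = 0 := by
  rw [crossingSum, Finset.sum_eq_zero, Finset.sum_eq_zero, mul_zero, add_zero]
  all_goals
    intro k hk
    rw [Finset.mem_Icc] at hk
    rw [delannoyInt_eq_zero (by omega), zero_mul]

lemma crossingSum_of_add_eq (h : i + j = n₂ + m₁) (hi : i ≤ n₁ + n₂) (hj : 0 ≤ j) (hj' : j ≤ m₁) :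
    crossingSum n₁ n₂ m₁ m₂ i j = delannoyInt (m₁ + m₂ - j) (n₁ + n₂ - i) := by
  obtain ⟨k, hk⟩ := Int.eq_ofNat_of_zero_le (show 0 ≤ m₁ - j by omega)
  rw [crossingSum, Finset.sum_eq_single k, Finset.sum_eq_zero, mul_zero, add_zero]
  · rw [show (m₁ - k - j : ℤ) = 0 by omega, show (n₂ + k - i : ℤ) = 0 by omega,
      delannoyInt_zero_zero, one_mul, ← delannoyInt_natCast]
    congr 1 <;> omega
  · intro l _
    rw [delannoyInt_eq_zero (by omega), zero_mul]
  · intro l _ hl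
    rw [delannoyInt_eq_zero (by omega), zero_mul]
  · intro hk'
    rw [Finset.mem_Icc] at hk'
    omega

lemma pathSum_of_le (h : n₂ + m₁ ≤ i + j) :
    pathSum n₁ n₂ m₁ m₂ i j = delannoyInt (m₁ + m₂ - j) (n₁ + n₂ - i) := if_pos h

lemma pathSum_eq_crossingSum (h : i + j ≤ n₂ + m₁) (hi : i ≤ n₁ + n₂) (hj : 0 ≤ j)
    (hj' : j ≤ m₁) : pathSum n₁ n₂ m₁ m₂ i j = crossingSum n₁ n₂ m₁ m₂ i j := by
  rcases h.lt_or_eq with h | h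
  · exact if_neg (by omega)
  · rw [pathSum_of_le h.ge, crossingSum_of_add_eq h hi hj hj']

lemma pathSum_end : pathSum n₁ n₂ m₁ m₂ (n₁ + n₂) (m₁ + m₂) = 1 := by
  rw [pathSum_of_le (by omega), sub_self, sub_self, delannoyInt_zero_zero]

lemma pathSum_last_row (hj : 0 ≤ j) (hj' : j < m₁ + m₂) :
    pathSum n₁ n₂ m₁ m₂ (n₁ + n₂) j = pathSum n₁ n₂ m₁ m₂ (n₁ + n₂) (j + 1) := by
  by_cases h : (n₂ + m₁ : ℤ) ≤ n₁ + n₂ + j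
  · rw [pathSum_of_le h, pathSum_of_le (by omega), sub_self, delannoyInt_zero_right (by omega),
      delannoyInt_zero_right (by omega)]
  · rw [pathSum_eq_crossingSum (by omega) le_rfl hj (by omega),
      pathSum_eq_crossingSum (by omega) le_rfl (by omega) (by omega),
      crossingSum_rec (by omega), crossingSum_eq_zero (i := _ + 1) (j := j) (by omega),
      crossingSum_eq_zero (i := _ + 1) (by omega), Finset.sum_eq_zero]
    · simp
    · intro k hk
      rw [Finset.mem_Icc] at hk
      exact if_neg (by omega)

lemma pathSum_last_column (hi : i < n₁ + n₂) (hj : j = m₁ + m₂ ∧ n₂ ≤ i ∨ j = m₁ ∧ i < n₂) :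
    pathSum n₁ n₂ m₁ m₂ i j = pathSum n₁ n₂ m₁ m₂ (i + 1) j := by
  by_cases h : n₂ + m₁ ≤ i + j
  · obtain ⟨rfl, -⟩ : j = m₁ + m₂ ∧ n₂ ≤ i := by omega
    rw [pathSum_of_le h, pathSum_of_le (by omega), sub_self, delannoyInt_zero_left (by omega),
      delannoyInt_zero_left (by omega)]
  · rw [pathSum_eq_crossingSum (by omega) (by omega) (by omega) (by omega),
      pathSum_eq_crossingSum (by omega) (by omega) (by omega) (by omega),
      crossingSum_rec (by omega), crossingSum_eq_zero (i := i) (j := _ + 1) (by omega),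
      crossingSum_eq_zero (j := _ + 1) (by omega), Finset.sum_eq_zero]
    · simp
    · intro k hk
      rw [Finset.mem_Icc] at hk
      exact if_neg (by omega)

lemma pathSum_across_antidiagonal (h : i + j + 1 = n₂ + m₁) (hi : i < n₁ + n₂) (hj : 0 ≤ j)
    (hj' : j < m₁) :
    pathSum n₁ n₂ m₁ m₂ i j = pathSum n₁ n₂ m₁ m₂ i (j + 1) + pathSum n₁ n₂ m₁ m₂ (i + 1) j +
      X * pathSum n₁ n₂ m₁ m₂ (i + 1) (j + 1) := by
  obtain ⟨k, hk⟩ := Int.eq_ofNat_of_zero_le (show 0 ≤ m₁ - j by omega)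
  rw [pathSum_eq_crossingSum (by omega) (by omega) (by omega) (by omega),
    pathSum_eq_crossingSum (by omega) (by omega) (by omega) (by omega),
    pathSum_eq_crossingSum (by omega) (by omega) (by omega) (by omega),
    pathSum_of_le (by omega), crossingSum_rec (by omega), Finset.sum_eq_single k,
    crossingSum_eq_zero (i := i + 1) (j := j + 1) (by omega), if_pos (by omega),
    ← delannoyInt_natCast, zero_add]
  · congr 3 <;> omega
  · intro l _ hl
    exact if_neg (by omega)
  · intro hk'
    rw [Finset.mem_Icc] at hk'
    omega

lemma pathSum_cell (hi : i < n₁ + n₂) (hj : 0 ≤ j) (hj' : j < m₁ ∨ n₂ ≤ i ∧ j < m₁ + m₂) :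
    pathSum n₁ n₂ m₁ m₂ i j = pathSum n₁ n₂ m₁ m₂ i (j + 1) + pathSum n₁ n₂ m₁ m₂ (i + 1) j +
      X * pathSum n₁ n₂ m₁ m₂ (i + 1) (j + 1) := by
  rcases lt_trichotomy (i + j + 1) (n₂ + m₁) with h | h | h
  · rw [pathSum_eq_crossingSum (by omega) (by omega) (by omega) (by omega),
      pathSum_eq_crossingSum (by omega) (by omega) (by omega) (by omega),
      pathSum_eq_crossingSum (by omega) (by omega) (by omega) (by omega),
      pathSum_eq_crossingSum (by omega) (by omega) (by omega) (by omega),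
      crossingSum_rec_of_add_one_lt h]
  · exact pathSum_across_antidiagonal h hi hj (by omega)
  · rw [pathSum_of_le (by omega), pathSum_of_le (by omega), pathSum_of_le (by omega),
      pathSum_of_le (by omega), delannoyInt_rec, if_neg (by omega), add_zero, sub_sub, sub_sub]

end PathSum
/-! ### Benzenoids with a unique source and a unique sink -/

section Honeycomb

open Set Function

variable {S : Finset (ℤ × ℤ)} {i j : ℤ} {c d : ℤ × ℤ}

/-- The lower end of the vertical edge with index `c`, the top corner of the cell `c`. The vertical
edges of the honeycomb lattice are indexed by the cells below them. -/
def edgeBottom (c : ℤ × ℤ) : ℤ × ℤ := (c.2 - c.1, 2 - 3 * (c.1 + c.2))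

/-- The upper end of the vertical edge with index `c`, the bottom corner of the cell
`(c.1 - 1, c.2 - 1)`. -/
def edgeTop (c : ℤ × ℤ) : ℤ × ℤ := (c.2 - c.1, 4 - 3 * (c.1 + c.2))

@[simp] lemma edgeBottom_inj : edgeBottom c = edgeBottom d ↔ c = d := by
  simp only [edgeBottom, Prod.ext_iff]
  omega

@[simp] lemma edgeTop_inj : edgeTop c = edgeTop d ↔ c = d := by
  simp only [edgeTop, Prod.ext_iff]
  omega

@[simp] lemma edgeBottom_ne_edgeTop : edgeBottom c ≠ edgeTop d := by
  simp only [edgeBottom, edgeTop, ne_eq, Prod.ext_iff]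
  omega

@[simp] lemma edgeTop_ne_edgeBottom : edgeTop c ≠ edgeBottom d := edgeBottom_ne_edgeTop.symm

lemma hexCorner_eq (i j : ℤ) :
    hexCorner (i, j) = ![edgeBottom (i, j), edgeTop (i, j + 1), edgeBottom (i, j + 1),
      edgeTop (i + 1, j + 1), edgeBottom (i + 1, j), edgeTop (i + 1, j)] := by
  ext t <;> fin_cases t <;> simp [hexCorner, hexOffset, edgeBottom, edgeTop] <;> ring

lemma hexCorner_injective (c : ℤ × ℤ) : Injective (hexCorner c) := by
  obtain ⟨i, j⟩ := c
  intro s t h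
  rw [hexCorner_eq] at h
  fin_cases s <;> fin_cases t <;> simp at h ⊢

lemma mem_benzenoidVertices {p : ℤ × ℤ} :
    p ∈ benzenoidVertices S ↔ ∃ c ∈ S, ∃ t, hexCorner c t = p := by
  simp [benzenoidVertices]

lemma edgeBottom_mem : edgeBottom (i, j) ∈ benzenoidVertices S ↔
    (i, j) ∈ S ∨ (i, j - 1) ∈ S ∨ (i - 1, j) ∈ S := by
  simp [mem_benzenoidVertices, hexCorner_eq, Fin.exists_fin_succ, ← eq_sub_iff_add_eq,
    and_or_left, exists_or]

lemma edgeTop_mem : edgeTop (i, j) ∈ benzenoidVertices S ↔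
    (i, j - 1) ∈ S ∨ (i - 1, j - 1) ∈ S ∨ (i - 1, j) ∈ S := by
  simp [mem_benzenoidVertices, hexCorner_eq, Fin.exists_fin_succ, ← eq_sub_iff_add_eq,
    and_or_left, exists_or]

lemma exists_eq_edgeBottom_or_edgeTop (v : benzenoidVertices S) :
    ∃ c, v.1 = edgeBottom c ∨ v.1 = edgeTop c := by
  obtain ⟨⟨i, j⟩, -, t, ht⟩ := mem_benzenoidVertices.1 v.2
  rw [← ht, hexCorner_eq]
  fin_cases t <;> simp

lemma benzenoid_adj_iff {u v : benzenoidVertices S} : (benzenoid S).Adj u v ↔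
    ∃ c ∈ S, ∃ t, u.1 = hexCorner c t ∧ v.1 = hexCorner c (t + 1) ∨
      v.1 = hexCorner c t ∧ u.1 = hexCorner c (t + 1) := by
  have corner_ne_succ (c : ℤ × ℤ) (t : Fin 6) : hexCorner c t ≠ hexCorner c (t + 1) :=
    (hexCorner_injective c).ne (by decide +revert)
  rw [benzenoid, SimpleGraph.fromRel_adj]
  constructor
  · rintro ⟨-, ⟨c, hc, t, h⟩ | ⟨c, hc, t, h⟩⟩
    exacts [⟨c, hc, t, Or.inl h⟩, ⟨c, hc, t, Or.inr h⟩]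
  · rintro ⟨c, hc, t, h | h⟩
    · refine ⟨fun huv => corner_ne_succ c t ?_, Or.inl ⟨c, hc, t, h⟩⟩
      rw [← h.1, ← h.2, huv]
    · refine ⟨fun huv => corner_ne_succ c t ?_, Or.inr ⟨c, hc, t, h⟩⟩
      rw [← h.1, ← h.2, huv]

lemma benzenoid_adj_edgeBottom {u v : benzenoidVertices S} (hu : u.1 = edgeBottom (i, j)) :
    (benzenoid S).Adj u v ↔
      v.1 = edgeTop (i, j) ∧ ((i - 1, j) ∈ S ∨ (i, j - 1) ∈ S) ∨
      v.1 = edgeTop (i, j + 1) ∧ ((i - 1, j) ∈ S ∨ (i, j) ∈ S) ∨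
      v.1 = edgeTop (i + 1, j) ∧ ((i, j - 1) ∈ S ∨ (i, j) ∈ S) := by
  simp only [benzenoid_adj_iff, hu, Fin.isValue, exists_or, Fin.exists_fin_succ, zero_add,
    Fin.succ_zero_eq_one, Fin.reduceAdd, Fin.succ_one_eq_two, Fin.reduceSucc, IsEmpty.exists_iff,
    or_false, and_or_left, Prod.exists, hexCorner_eq, Nat.succ_eq_add_one, Nat.reduceAdd,
    Matrix.cons_val_zero, edgeBottom_inj, Prod.mk.injEq, @eq_comm _ i, @eq_comm _ j,
    Matrix.cons_val_one, ↓existsAndEq, and_true, true_and, edgeBottom_ne_edgeTop, Matrix.cons_val,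
    false_and, and_false, exists_const, ← eq_sub_iff_add_eq, sub_add_cancel, false_or,
    exists_eq_right_right]
  tauto

lemma eq_of_benzenoid_adj_edgeTop {u v : benzenoidVertices S} (hu : u.1 = edgeTop (i, j))
    (huv : (benzenoid S).Adj u v) :
    v.1 = edgeBottom (i, j) ∨ v.1 = edgeBottom (i, j - 1) ∨ v.1 = edgeBottom (i - 1, j) := by
  obtain ⟨⟨a, b⟩, hv | hv⟩ := exists_eq_edgeBottom_or_edgeTop v
  · have huv := (benzenoid_adj_edgeBottom hv).1 huv.symm
    simp only [hu, edgeTop_inj, Prod.mk.injEq] at huv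
    simp only [hv, edgeBottom_inj, Prod.mk.injEq]
    omega
  · simp [benzenoid_adj_iff, hu, hv, hexCorner_eq, Fin.exists_fin_succ] at huv

/-- The corners of a cell of `S`, as vertices of the benzenoid. -/
def cellHexagon (hc : c ∈ S) (t : Fin 6) : benzenoidVertices S :=
  ⟨hexCorner c t, mem_benzenoidVertices.2 ⟨c, hc, t, rfl⟩⟩

lemma cellHexagon_injective (hc : c ∈ S) : Injective (cellHexagon hc) := fun _ _ h =>
  hexCorner_injective c (congrArg Subtype.val h)

lemma benzenoid_adj_cellHexagon (hc : c ∈ S) (t : Fin 6) :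
    (benzenoid S).Adj (cellHexagon hc t) (cellHexagon hc (t + 1)) :=
  benzenoid_adj_iff.2 ⟨c, hc, t, Or.inl ⟨rfl, rfl⟩⟩

lemma val_cellHexagon (hc : (i, j) ∈ S) (t : Fin 6) :
    (cellHexagon hc t).1 = ![edgeBottom (i, j), edgeTop (i, j + 1), edgeBottom (i, j + 1),
      edgeTop (i + 1, j + 1), edgeBottom (i + 1, j), edgeTop (i + 1, j)] t := by
  simp only [cellHexagon, hexCorner_eq]

lemma eq_cellHexagon (hc : c ∈ S) {g : Fin 6 → benzenoidVertices S} (hg : Injective g)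
    (hadj : ∀ t, (benzenoid S).Adj (g t) (g (t + 1))) (h0 : g 0 = cellHexagon hc 0)
    (h1 : g 1 = cellHexagon hc 1) (h5 : g 5 = cellHexagon hc 5) : g = cellHexagon hc := by
  obtain ⟨i, j⟩ := c
  have g0 : (g 0).1 = edgeBottom (i, j) := by rw [h0, val_cellHexagon]; rfl
  have g1 : (g 1).1 = edgeTop (i, j + 1) := by rw [h1, val_cellHexagon]; rfl
  have g5 : (g 5).1 = edgeTop (i + 1, j) := by rw [h5, val_cellHexagon]; rfl
  have g_ne {s t : Fin 6} (hst : s ≠ t) : (g s).1 ≠ (g t).1 := Subtype.val_injective.ne (hg.ne hst)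
  have g2 : (g 2).1 = edgeBottom (i, j + 1) ∨ (g 2).1 = edgeBottom (i - 1, j + 1) := by
    have h := eq_of_benzenoid_adj_edgeTop g1 (hadj 1)
    rw [add_sub_cancel_right, ← g0] at h
    exact h.imp_right (Or.resolve_left · (g_ne (by decide)))
  have g4 : (g 4).1 = edgeBottom (i + 1, j) ∨ (g 4).1 = edgeBottom (i + 1, j - 1) := by
    have h := eq_of_benzenoid_adj_edgeTop g5 (hadj 4).symm
    rw [add_sub_cancel_right, ← g0] at h
    exact h.imp_right (Or.resolve_right · (g_ne (by decide)))
  have h13 := g_ne (show (1 : Fin 6) ≠ 3 by decide)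
  have h53 := g_ne (show (5 : Fin 6) ≠ 3 by decide)
  rw [g1] at h13
  rw [g5] at h53
  have g3 : (g 2).1 = edgeBottom (i, j + 1) ∧ (g 3).1 = edgeTop (i + 1, j + 1) ∧
      (g 4).1 = edgeBottom (i + 1, j) := by
    rcases g2 with g2 | g2 <;> rcases g4 with g4 | g4
    all_goals
      have from_two := (benzenoid_adj_edgeBottom g2).1 (hadj 2)
      have from_four := (benzenoid_adj_edgeBottom g4).1 (hadj 3).symm
      grind [edgeTop_inj]
  ext1 t
  refine Subtype.ext ((?_ : _ = _).trans (val_cellHexagon hc t).symm)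
  fin_cases t
  exacts [g0, g1, g3.1, g3.2.1, g3.2.2, g5]

/-- The vertices that remain when the part of a Clar cover above the top corner of the cell `p` has
been removed: that corner, and the ends of the vertical edges with index in `D`. -/
def remainder (S : Finset (ℤ × ℤ)) (D : Set (ℤ × ℤ)) (p : ℤ × ℤ) : Set (benzenoidVertices S) :=
  {v | v.1 ∈ edgeBottom '' insert p D ∪ edgeTop '' D}

variable {D : Set (ℤ × ℤ)} {p : ℤ × ℤ}

lemma mem_remainder {v : benzenoidVertices S} :
    v ∈ remainder S D p ↔ v.1 ∈ edgeBottom '' insert p D ∪ edgeTop '' D := Iff.rfl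

lemma mem_remainder_of_eq_edgeBottom {v : benzenoidVertices S} (hv : v.1 = edgeBottom c) :
    v ∈ remainder S D p ↔ c ∈ insert p D := by
  simp [remainder, hv, eq_comm, -Prod.exists]

lemma mem_remainder_of_eq_edgeTop {v : benzenoidVertices S} (hv : v.1 = edgeTop c) :
    v ∈ remainder S D p ↔ c ∈ D := by
  simp [remainder, hv, eq_comm, -Prod.exists]

lemma remainder_compl_singleton (p : ℤ × ℤ) (hp : edgeTop p ∉ benzenoidVertices S) :
    remainder S {p}ᶜ p = univ := by
  refine eq_univ_of_forall fun v => ?_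
  obtain ⟨c, hv | hv⟩ := exists_eq_edgeBottom_or_edgeTop v
  · simp [mem_remainder_of_eq_edgeBottom hv, em]
  · rw [mem_remainder_of_eq_edgeTop hv]
    rintro rfl
    exact hp (hv ▸ v.2)

lemma remainder_sdiff {F : Set (benzenoidVertices S)} {A B D' : Set (ℤ × ℤ)} {p' : ℤ × ℤ}
    (hA : ∀ v c, v.1 = edgeBottom c → (v ∈ F ↔ c ∈ A))
    (hB : ∀ v c, v.1 = edgeTop c → (v ∈ F ↔ c ∈ B)) (hbottom : insert p D \ A = insert p' D')
    (htop : D \ B = D') : remainder S D p \ F = remainder S D' p' := by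
  ext v
  obtain ⟨c, hv | hv⟩ := exists_eq_edgeBottom_or_edgeTop v
  · rw [mem_remainder_of_eq_edgeBottom hv, ← hbottom, mem_sdiff, mem_sdiff, hA v c hv,
      mem_remainder_of_eq_edgeBottom hv]
  · rw [mem_remainder_of_eq_edgeTop hv, ← htop, mem_sdiff, mem_sdiff, hB v c hv,
      mem_remainder_of_eq_edgeTop hv]

lemma remainder_sdiff_pair {u a : benzenoidVertices S} {D' : Set (ℤ × ℤ)} {p' : ℤ × ℤ}
    (hu : u.1 = edgeBottom c) (ha : a.1 = edgeTop d) (hbottom : insert p D \ {c} = insert p' D')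
    (htop : D \ {d} = D') : remainder S D p \ {u, a} = remainder S D' p' := by
  refine remainder_sdiff (fun v e hv => ?_) (fun v e hv => ?_) hbottom htop <;>
    simp [Subtype.ext_iff, hv, hu, ha]

lemma remainder_sdiff_step {u a : benzenoidVertices S} (hu : u.1 = edgeBottom p)
    (ha : a.1 = edgeTop c) (hp : p ∉ D) (hc : c ∈ D) :
    remainder S D p \ {u, a} = remainder S (D \ {c}) c := by
  refine remainder_sdiff_pair hu ha ?_ rfl
  rw [insert_sdiff_self_of_notMem hp, insert_sdiff_singleton, insert_eq_of_mem hc]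

lemma remainder_sdiff_edge {u a : benzenoidVertices S} (hu : u.1 = edgeBottom c)
    (ha : a.1 = edgeTop c) (hc : p ≠ c) :
    remainder S D p \ {u, a} = remainder S (D \ {c}) p :=
  remainder_sdiff_pair hu ha (insert_sdiff_of_notMem _ hc) rfl

lemma remainder_sdiff_cellHexagon (hS : (i, j) ∈ S) (hp : (i, j) ∉ D)
    (hD : (i + 1, j + 1) ∈ D) :
    remainder S D (i, j) \ range (cellHexagon hS) =
      remainder S (D \ {(i, j + 1), (i + 1, j + 1), (i + 1, j)}) (i + 1, j + 1) := by
  refine remainder_sdiff (A := {(i, j), (i, j + 1), (i + 1, j)})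
    (B := {(i, j + 1), (i + 1, j + 1), (i + 1, j)}) (fun v c hv => ?_) (fun v c hv => ?_) ?_ rfl
  · simp [Subtype.ext_iff, hv, val_cellHexagon, Fin.exists_fin_succ, @eq_comm _ c]
  · simp [Subtype.ext_iff, hv, val_cellHexagon, Fin.exists_fin_succ, @eq_comm _ c]
  · ext ⟨k, l⟩
    simp only [mem_sdiff, mem_insert_iff, mem_singleton_iff, Prod.mk.injEq]
    grind

lemma remainder_ssubset {D' : Set (ℤ × ℤ)} {q : ℤ × ℤ} (hpS : edgeBottom p ∈ benzenoidVertices S)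
    (hp : p ∉ D) (hq : q ∈ D) (hD' : D' ⊆ D) : remainder S D' q ⊂ remainder S D p := by
  have insert_subset : insert q D' ⊆ D := insert_subset hq hD'
  refine ⟨fun v hv => ?_, fun h => hp ?_⟩
  · exact hv.imp (fun hv => image_mono (insert_subset.trans (subset_insert p D)) hv)
      (fun hv => image_mono hD' hv)
  · exact insert_subset ((mem_remainder_of_eq_edgeBottom (v := ⟨_, hpS⟩) rfl).1
      (h ((mem_remainder_of_eq_edgeBottom rfl).2 (mem_insert p D))))

section Step

variable (hp : (i, j) ∉ D) (hD : ∀ c : ℤ × ℤ, i + j < c.1 + c.2 → c ∈ D)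

include hp hD

lemma coverPoly_remainder_of_mem (hS : (i, j) ∈ S) :
    coverPoly (benzenoid S) (remainder S D (i, j)) =
      coverPoly (benzenoid S) (remainder S (D \ {(i, j + 1)}) (i, j + 1)) +
      coverPoly (benzenoid S) (remainder S (D \ {(i + 1, j)}) (i + 1, j)) +
      X * coverPoly (benzenoid S)
        (remainder S (D \ {(i, j + 1), (i + 1, j + 1), (i + 1, j)}) (i + 1, j + 1)) := by
  have right_mem : (i, j + 1) ∈ D := hD _ (by dsimp only; omega)
  have left_mem : (i + 1, j) ∈ D := hD _ (by dsimp only; omega)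
  have diag_mem : (i + 1, j + 1) ∈ D := hD _ (by dsimp only; omega)
  have hexagon_mem (t : Fin 6) : cellHexagon hS t ∈ remainder S D (i, j) := by
    rw [mem_remainder, val_cellHexagon]
    fin_cases t <;> simp [*]
  rw [coverPoly_of_two_neighbors (cellHexagon_injective hS) hexagon_mem
    (benzenoid_adj_cellHexagon hS) ?_ (fun _ => eq_cellHexagon hS),
    remainder_sdiff_step (val_cellHexagon hS 0) (val_cellHexagon hS 1) hp right_mem,
    remainder_sdiff_step (val_cellHexagon hS 0) (val_cellHexagon hS 5) hp left_mem,
    remainder_sdiff_cellHexagon hS hp diag_mem]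
  intro w hw hadj
  obtain ⟨h, -⟩ | ⟨h, -⟩ | ⟨h, -⟩ := (benzenoid_adj_edgeBottom (val_cellHexagon hS 0)).1 hadj
  · exact absurd ((mem_remainder_of_eq_edgeTop h).1 hw) hp
  · exact Or.inl (Subtype.ext (h.trans (val_cellHexagon hS 1).symm))
  · exact Or.inr (Subtype.ext (h.trans (val_cellHexagon hS 5).symm))

lemma coverPoly_remainder_of_left_notMem (hS : (i - 1, j) ∈ S) (hij : (i, j) ∉ S)
    (hS' : (i, j - 1) ∉ S) :
    coverPoly (benzenoid S) (remainder S D (i, j)) =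
      coverPoly (benzenoid S) (remainder S (D \ {(i, j + 1)}) (i, j + 1)) := by
  have right_mem : (i, j + 1) ∈ D := hD _ (by dsimp only; omega)
  obtain ⟨u, hu⟩ : ∃ u : benzenoidVertices S, u.1 = edgeBottom (i, j) :=
    ⟨⟨_, edgeBottom_mem.2 (by tauto)⟩, rfl⟩
  obtain ⟨a, ha⟩ : ∃ a : benzenoidVertices S, a.1 = edgeTop (i, j + 1) :=
    ⟨⟨_, edgeTop_mem.2 (by simp [hS])⟩, rfl⟩
  rw [coverPoly_of_unique_neighbor ((mem_remainder_of_eq_edgeBottom hu).2 (mem_insert _ D))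
    ((mem_remainder_of_eq_edgeTop ha).2 right_mem) ((benzenoid_adj_edgeBottom hu).2 (by tauto)),
    remainder_sdiff_step hu ha hp right_mem]
  intro w hw hadj
  obtain ⟨h, -⟩ | ⟨h, -⟩ | ⟨-, h⟩ := (benzenoid_adj_edgeBottom hu).1 hadj
  · exact absurd ((mem_remainder_of_eq_edgeTop h).1 hw) hp
  · exact Subtype.ext (h.trans ha.symm)
  · tauto

lemma coverPoly_remainder_of_right_notMem (hS : (i, j - 1) ∈ S) (hij : (i, j) ∉ S)
    (hS' : (i - 1, j) ∉ S) :
    coverPoly (benzenoid S) (remainder S D (i, j)) =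
      coverPoly (benzenoid S) (remainder S (D \ {(i + 1, j)}) (i + 1, j)) := by
  have left_mem : (i + 1, j) ∈ D := hD _ (by dsimp only; omega)
  obtain ⟨u, hu⟩ : ∃ u : benzenoidVertices S, u.1 = edgeBottom (i, j) :=
    ⟨⟨_, edgeBottom_mem.2 (by tauto)⟩, rfl⟩
  obtain ⟨a, ha⟩ : ∃ a : benzenoidVertices S, a.1 = edgeTop (i + 1, j) :=
    ⟨⟨_, edgeTop_mem.2 (by simp [hS])⟩, rfl⟩
  rw [coverPoly_of_unique_neighbor ((mem_remainder_of_eq_edgeBottom hu).2 (mem_insert _ D))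
    ((mem_remainder_of_eq_edgeTop ha).2 left_mem) ((benzenoid_adj_edgeBottom hu).2 (by tauto)),
    remainder_sdiff_step hu ha hp left_mem]
  intro w hw hadj
  obtain ⟨h, -⟩ | ⟨-, h⟩ | ⟨h, -⟩ := (benzenoid_adj_edgeBottom hu).1 hadj
  · exact absurd ((mem_remainder_of_eq_edgeTop h).1 hw) hp
  · tauto
  · exact Subtype.ext (h.trans ha.symm)

end Step

end Honeycomb

section SourceSink

open Set

/-- The cells of `S` form a region of the lattice that is entered only at its topmost vertex, the
top corner of the cell `s`, and left only at its bottommost vertex, the bottom corner of the cell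
`(e.1 - 1, e.2 - 1)`: every other cell of `S` has an upper neighbour in `S`, resp. a lower one. -/
structure HasSourceSink (S : Finset (ℤ × ℤ)) (s e : ℤ × ℤ) : Prop where
  source_mem : s ∈ S
  eq_source_or_pred {i j : ℤ} : (i, j) ∈ S → (i, j) = s ∨ (i - 1, j) ∈ S ∨ (i, j - 1) ∈ S
  eq_sink_or_succ {i j : ℤ} :
    (i, j) ∈ S → (i + 1, j + 1) = e ∨ (i + 1, j) ∈ S ∨ (i, j + 1) ∈ S
  mem_of_preds {i j : ℤ} : (i - 1, j) ∈ S → (i, j - 1) ∈ S → (i, j) ∈ S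
  edgeTop_source : edgeTop s ∉ benzenoidVertices S
  edgeBottom_sink : edgeBottom e ∉ benzenoidVertices S

/-- The recurrence for the weighted number `F i j` of lattice paths from `(i, j)` to `e` with steps
`(0, 1)` and `(1, 0)` of weight `1` along the sides of the cells of `S`, and diagonal steps `(1, 1)`
of weight `X` across the cells of `S`. -/
structure IsPathCount (S : Finset (ℤ × ℤ)) (e : ℤ × ℤ) (F : ℤ → ℤ → ℤ[X]) : Prop where
  sink : F e.1 e.2 = 1
  cell {i j : ℤ} : (i, j) ∈ S → F i j = F i (j + 1) + F (i + 1) j + X * F (i + 1) (j + 1)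
  right_only {i j : ℤ} : (i - 1, j) ∈ S → (i, j) ∉ S → F i j = F i (j + 1)
  left_only {i j : ℤ} : (i, j - 1) ∈ S → (i, j) ∉ S → F i j = F (i + 1) j

variable {S : Finset (ℤ × ℤ)} {s e p : ℤ × ℤ} {D : Set (ℤ × ℤ)} {F : ℤ → ℤ → ℤ[X]} {i j : ℤ}

namespace HasSourceSink

variable (hS : HasSourceSink S s e)

include hS

lemma edgeTop_mem_iff {c : ℤ × ℤ} (hs : c ≠ s) (he : c ≠ e) :
    edgeTop c ∈ benzenoidVertices S ↔ edgeBottom c ∈ benzenoidVertices S := by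
  obtain ⟨i, j⟩ := c
  rw [edgeTop_mem, edgeBottom_mem]
  have pred := hS.eq_source_or_pred (i := i) (j := j)
  have succ := hS.eq_sink_or_succ (i := i - 1) (j := j - 1)
  simp only [sub_add_cancel] at succ
  tauto

lemma exists_adj_of_edgeBottom_mem {c : ℤ × ℤ} (hs : c ≠ s) (he : c ≠ e)
    (hc : edgeBottom c ∈ benzenoidVertices S) :
    ∃ u a : benzenoidVertices S, u.1 = edgeBottom c ∧ a.1 = edgeTop c ∧ (benzenoid S).Adj u a := by
  refine ⟨⟨_, hc⟩, ⟨_, (hS.edgeTop_mem_iff hs he).2 hc⟩, rfl, rfl, ?_⟩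
  obtain ⟨i, j⟩ := c
  rw [edgeBottom_mem] at hc
  have pred := hS.eq_source_or_pred (i := i) (j := j)
  rw [benzenoid_adj_edgeBottom rfl]
  exact Or.inl ⟨rfl, by tauto⟩

lemma exists_lowest_edge (hs : s ∉ D) (he : e ∉ D) (hD : (remainder S D e).Nonempty) :
    ∃ c ∈ D, edgeBottom c ∈ benzenoidVertices S ∧
      ∀ d ∈ D, c.1 + c.2 < d.1 + d.2 → edgeTop d ∉ benzenoidVertices S := by
  let E : Set (ℤ × ℤ) := {c | c ∈ D ∧ edgeBottom c ∈ benzenoidVertices S}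
  have finite : E.Finite := ((benzenoidVertices S).finite_toSet.preimage
    fun _ _ _ _ h => edgeBottom_inj.1 h).subset fun c hc => hc.2
  have edgeBottom_mem_of_edgeTop_mem {c : ℤ × ℤ} (hc : c ∈ D)
      (hv : edgeTop c ∈ benzenoidVertices S) : edgeBottom c ∈ benzenoidVertices S :=
    (hS.edgeTop_mem_iff (ne_of_mem_of_not_mem hc hs) (ne_of_mem_of_not_mem hc he)).1 hv
  have nonempty : E.Nonempty := by
    obtain ⟨v, hv⟩ := hD
    obtain ⟨c, hc | hc⟩ := exists_eq_edgeBottom_or_edgeTop v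
    · have hcD := (mem_remainder_of_eq_edgeBottom hc).1 hv
      refine ⟨c, hcD.resolve_left ?_, hc ▸ v.2⟩
      rintro rfl
      exact hS.edgeBottom_sink (hc ▸ v.2)
    · have hcD := (mem_remainder_of_eq_edgeTop hc).1 hv
      exact ⟨c, hcD, edgeBottom_mem_of_edgeTop_mem hcD (hc ▸ v.2)⟩
  obtain ⟨c, hc, hmax⟩ := exists_max_image E (fun c => c.1 + c.2) finite nonempty
  exact ⟨c, hc.1, hc.2, fun d hd hcd hv =>
    (hmax d ⟨hd, edgeBottom_mem_of_edgeTop_mem hd hv⟩).not_gt hcd⟩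

-- Once the path has reached the sink, vertical edges remain; the lowest is forced to be a bond.
lemma coverPoly_remainder_sink (hs : s ∉ D) (he : e ∉ D) :
    coverPoly (benzenoid S) (remainder S D e) = 1 := by
  induction hW : remainder S D e using WellFoundedLT.induction generalizing D with
  | ind W ih =>
  subst hW
  rcases (remainder S D e).eq_empty_or_nonempty with h | h
  · rw [h, coverPoly_empty]
  obtain ⟨⟨i, j⟩, hcD, hc, lowest⟩ := hS.exists_lowest_edge hs he h
  have hce := ne_of_mem_of_not_mem hcD he
  obtain ⟨u, a, hu, ha, hua⟩ :=
    hS.exists_adj_of_edgeBottom_mem (ne_of_mem_of_not_mem hcD hs) hce hc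
  have hu_mem := (mem_remainder_of_eq_edgeBottom (p := e) hu).2 (Or.inr hcD)
  have ha_mem := (mem_remainder_of_eq_edgeTop (p := e) ha).2 hcD
  rw [coverPoly_of_unique_neighbor hu_mem ha_mem hua]
  · refine ih _ ?_ (fun h => hs h.1) (fun h => he h.1) (remainder_sdiff_edge hu ha hce.symm).symm
    exact ⟨sdiff_subset, fun h => (h hu_mem).2 (mem_insert u {a})⟩
  · intro w hw huw
    have not_above {d : ℤ × ℤ} (hd : i + j < d.1 + d.2) : w.1 ≠ edgeTop d := fun hwd =>
      lowest d ((mem_remainder_of_eq_edgeTop hwd).1 hw) hd (hwd ▸ w.2)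
    obtain ⟨h, -⟩ | ⟨h, -⟩ | ⟨h, -⟩ := (benzenoid_adj_edgeBottom hu).1 huw
    · exact Subtype.ext (h.trans ha.symm)
    · exact absurd h (not_above (by dsimp only; omega))
    · exact absurd h (not_above (by dsimp only; omega))

lemma eq_sink_or_edgeBottom_mem (h : (i, j) ∈ S) :
    (i + 1, j + 1) = e ∨ edgeBottom (i + 1, j + 1) ∈ benzenoidVertices S := by
  refine (hS.eq_sink_or_succ h).imp_right fun h => edgeBottom_mem.2 (Or.inr ?_)
  simpa only [add_sub_cancel_right] using h

theorem coverPoly_remainder (hF : IsPathCount S e F) (hs : s ∉ D) (hp : p ∉ D)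
    (hD : ∀ c : ℤ × ℤ, p.1 + p.2 < c.1 + c.2 → c ∈ D)
    (hpS : p = e ∨ edgeBottom p ∈ benzenoidVertices S) :
    coverPoly (benzenoid S) (remainder S D p) = F p.1 p.2 := by
  induction hW : remainder S D p using WellFoundedLT.induction generalizing D p with
  | ind W ih =>
  subst hW
  rcases hpS with rfl | hpS
  · rw [hF.sink, hS.coverPoly_remainder_sink hs hp]
  have advance {T : Set (ℤ × ℤ)} {q : ℤ × ℤ} (hpq : p.1 + p.2 < q.1 + q.2) (hq : q ∈ T)
      (hT : ∀ t ∈ T, t.1 + t.2 ≤ q.1 + q.2)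
      (hqS : q = e ∨ edgeBottom q ∈ benzenoidVertices S) :
      coverPoly (benzenoid S) (remainder S (D \ T) q) = F q.1 q.2 :=
    ih _ (remainder_ssubset hpS hp (hD q hpq) sdiff_subset) (fun h => hs h.1) (fun h => h.2 hq)
      (fun c hc => mem_sdiff_of_mem (hD c (hpq.trans hc)) fun h => (hT c h).not_gt hc) hqS rfl
  obtain ⟨i, j⟩ := p
  have right : _ → coverPoly (benzenoid S) (remainder S (D \ {(i, j + 1)}) (i, j + 1)) = _ :=
    advance (by dsimp only; omega) (mem_singleton _) (by rintro _ rfl; rfl)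
  have left : _ → coverPoly (benzenoid S) (remainder S (D \ {(i + 1, j)}) (i + 1, j)) = _ :=
    advance (by dsimp only; omega) (mem_singleton _) (by rintro _ rfl; rfl)
  by_cases hij : (i, j) ∈ S
  · rw [coverPoly_remainder_of_mem hp hD hij, hF.cell hij,
      right (Or.inr (edgeBottom_mem.2 (by simp [hij]))),
      left (Or.inr (edgeBottom_mem.2 (by simp [hij]))),
      advance (by dsimp only; omega) (by simp) ?_ (hS.eq_sink_or_edgeBottom_mem hij)]
    rintro _ (rfl | rfl | rfl) <;> dsimp only <;> omega
  · rcases (edgeBottom_mem.1 hpS).resolve_left hij with h | h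
    · rw [coverPoly_remainder_of_right_notMem hp hD h hij (fun h' => hij (hS.mem_of_preds h' h)),
        hF.left_only h hij, left (by simpa using hS.eq_sink_or_edgeBottom_mem h)]
    · rw [coverPoly_remainder_of_left_notMem hp hD h hij (fun h' => hij (hS.mem_of_preds h h')),
        hF.right_only h hij, right (by simpa using hS.eq_sink_or_edgeBottom_mem h)]

theorem ZZ_benzenoid (hF : IsPathCount S e F) : ZZ (benzenoid S) = F s.1 s.2 := by
  rw [← coverPoly_univ, ← remainder_compl_singleton s hS.edgeTop_source]
  refine hS.coverPoly_remainder hF (by simp) (by simp) (fun c hc => ?_)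
    (Or.inr (edgeBottom_mem.2 (Or.inl hS.source_mem)))
  rintro rfl
  exact hc.false

end HasSourceSink

end SourceSink
section Rectangle

variable {a a' b b' : ℤ}

lemma hasSourceSink_rectangle (ha : a < a') (hb : b < b') :
    HasSourceSink (Finset.Ico a a' ×ˢ Finset.Ico b b') (a, b) (a', b') := by
  constructor <;> intros <;>
    simp only [edgeTop_mem, edgeBottom_mem, Finset.mem_product, Finset.mem_Ico,
      Prod.mk.injEq] at * <;>
    omega

lemma isPathCount_rectangle :
    IsPathCount (Finset.Ico a a' ×ˢ Finset.Ico b b') (a', b')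
      fun i j => delannoyInt (b' - j) (a' - i) where
  sink := by simp only [sub_self, delannoyInt_zero_zero]
  cell h := by
    simp only [Finset.mem_product, Finset.mem_Ico] at h
    rw [delannoyInt_rec_of_pos (by omega) (by omega)]
    simp only [sub_sub]
  right_only {i j} h h' := by
    simp only [Finset.mem_product, Finset.mem_Ico] at h h'
    obtain rfl : i = a' := by omega
    rw [sub_self, delannoyInt_zero_right (by omega), delannoyInt_zero_right (by omega)]
  left_only {i j} h h' := by
    simp only [Finset.mem_product, Finset.mem_Ico] at h h'
    obtain rfl : j = b' := by omega
    rw [sub_self, delannoyInt_zero_left (by omega), delannoyInt_zero_left (by omega)]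

lemma ZZ_benzenoid_of_eq_empty {S : Finset (ℤ × ℤ)} (hS : S = ∅) : ZZ (benzenoid S) = 1 := by
  subst hS
  have : IsEmpty (benzenoidVertices ∅) := Finset.isEmpty_coe_sort.2 rfl
  rw [← coverPoly_univ, Set.univ_eq_empty_iff.2 this, coverPoly_empty]

variable (a a' b b') in
theorem ZZ_benzenoid_rectangle :
    ZZ (benzenoid (Finset.Ico a a' ×ˢ Finset.Ico b b')) =
      delannoy (b' - b).toNat (a' - a).toNat := by
  rcases le_or_gt a' a with ha | ha
  · rw [ZZ_benzenoid_of_eq_empty (by rw [Finset.Ico_eq_empty_of_le ha, Finset.empty_product]),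
      Int.toNat_of_nonpos (sub_nonpos.2 ha), delannoy_zero_right]
  rcases le_or_gt b' b with hb | hb
  · rw [ZZ_benzenoid_of_eq_empty (by rw [Finset.Ico_eq_empty_of_le hb, Finset.product_empty]),
      Int.toNat_of_nonpos (sub_nonpos.2 hb), delannoy_zero_left]
  · rw [(hasSourceSink_rectangle ha hb).ZZ_benzenoid isPathCount_rectangle, delannoyInt,
      if_pos ⟨sub_nonneg.2 hb.le, sub_nonneg.2 ha.le⟩]

theorem ZZ_parallelogram (m n : ℕ) : ZZ (parallelogram m n) = delannoy m n := by
  rw [parallelogram, parallelogramCells, ZZ_benzenoid_rectangle, sub_zero, sub_zero,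
    Int.toNat_natCast, Int.toNat_natCast]

end Rectangle

section Ribbon

variable {n₁ m₁ : ℕ} (n₂ m₂ : ℕ)

lemma mem_ribbonCells {i j : ℤ} : (i, j) ∈ ribbonCells n₁ n₂ m₁ m₂ ↔
    0 ≤ i ∧ i < n₁ + n₂ ∧ 0 ≤ j ∧ (j < m₁ ∨ n₂ ≤ i ∧ j < m₁ + m₂) := by
  simp only [ribbonCells, Finset.mem_union, Finset.mem_product, Finset.mem_Ico]
  omega

lemma hasSourceSink_ribbon (hn : 0 < n₁) (hm : 0 < m₁) :
    HasSourceSink (ribbonCells n₁ n₂ m₁ m₂) (0, 0) (n₁ + n₂, m₁ + m₂) := by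
  constructor <;> intros <;>
    simp only [edgeTop_mem, edgeBottom_mem, mem_ribbonCells, Prod.mk.injEq] at * <;>
    omega

lemma isPathCount_ribbon :
    IsPathCount (ribbonCells n₁ n₂ m₁ m₂) (n₁ + n₂, m₁ + m₂) (pathSum n₁ n₂ m₁ m₂) where
  sink := pathSum_end
  cell h := by
    obtain ⟨-, hi, hj, hj'⟩ := (mem_ribbonCells n₂ m₂).1 h
    exact pathSum_cell hi hj hj'
  right_only {i j} h h' := by
    rw [mem_ribbonCells] at h h'
    obtain rfl : i = n₁ + n₂ := by omega
    exact pathSum_last_row (by omega) (by omega)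
  left_only h h' := by
    rw [mem_ribbonCells] at h h'
    exact pathSum_last_column (by omega) (by omega)

end Ribbon

section Formulas

variable (n₁ n₂ m₁ m₂ : ℕ)

lemma ZZ_ribbon_of_pos {n₁ m₁ : ℕ} (hn : 0 < n₁) (hm : 0 < m₁) :
    ZZ (ribbon n₁ n₂ m₁ m₂) = crossingSum n₁ n₂ m₁ m₂ 0 0 := by
  rw [ribbon, (hasSourceSink_ribbon n₂ m₂ hn hm).ZZ_benzenoid (isPathCount_ribbon n₂ m₂),
    pathSum_eq_crossingSum (by omega) (by omega) le_rfl (by omega)]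

lemma ZZ_ribbon_zero_left : ZZ (ribbon 0 n₂ m₁ m₂) = delannoy m₁ n₂ := by
  have cells : ribbonCells 0 n₂ m₁ m₂ = parallelogramCells m₁ n₂ := by
    simp [ribbonCells, parallelogramCells]
  rw [ribbon, cells, ← ZZ_parallelogram, parallelogram]

lemma ZZ_ribbon_zero_right : ZZ (ribbon n₁ n₂ 0 m₂) = delannoy m₂ n₁ := by
  have cells : ribbonCells n₁ n₂ 0 m₂ =
      Finset.Ico (n₂ : ℤ) (n₁ + n₂) ×ˢ Finset.Ico (0 : ℤ) m₂ := by
    simp [ribbonCells]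
  rw [ribbon, cells, ZZ_benzenoid_rectangle, sub_zero, add_sub_cancel_right, Int.toNat_natCast,
    Int.toNat_natCast]

lemma crossingSum_zero_zero :
    crossingSum n₁ n₂ m₁ m₂ 0 0 =
      ∑ k ∈ Finset.Icc 0 (min n₁ m₁), delannoy (m₁ - k) (n₂ + k) * delannoy (m₂ + k) (n₁ - k) +
      X * ∑ k ∈ Finset.Icc 1 (min n₁ m₁),
        delannoy (m₁ - k) (n₂ + k - 1) * delannoy (m₂ + k - 1) (n₁ - k) := by
  rw [crossingSum]
  congr 1
  · refine Finset.sum_congr rfl fun k hk => ?_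
    obtain ⟨-, hk⟩ := Finset.mem_Icc.1 hk
    rw [← delannoyInt_natCast (m₁ - k)]
    congr 2
    omega
  · congr 1
    refine Finset.sum_congr rfl fun k hk => ?_
    obtain ⟨hk1, hk⟩ := Finset.mem_Icc.1 hk
    rw [← delannoyInt_natCast (m₁ - k)]
    congr 2 <;> omega

theorem ZZ_ribbon :
    ZZ (ribbon n₁ n₂ m₁ m₂) =
      ∑ k ∈ Finset.Icc 0 (min n₁ m₁), delannoy (m₁ - k) (n₂ + k) * delannoy (m₂ + k) (n₁ - k) +
      X * ∑ k ∈ Finset.Icc 1 (min n₁ m₁),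
        delannoy (m₁ - k) (n₂ + k - 1) * delannoy (m₂ + k - 1) (n₁ - k) := by
  rcases n₁.eq_zero_or_pos with rfl | hn
  · simp [ZZ_ribbon_zero_left]
  rcases m₁.eq_zero_or_pos with rfl | hm
  · simp [ZZ_ribbon_zero_right]
  · rw [ZZ_ribbon_of_pos n₂ m₂ hn hm, crossingSum_zero_zero]

theorem ZZ_ribbon_eq_triple_sum :
    ZZ (ribbon n₁ n₂ m₁ m₂) =
      ∑ k ∈ Finset.Icc 0 (min n₁ m₁), ∑ j ∈ Finset.Icc 0 (m₁ - k), ∑ i ∈ Finset.Icc 0 (n₁ - k),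
        ((m₁ - k).choose j * (n₂ + k).choose j * (m₂ + k).choose i * (n₁ - k).choose i : ℤ[X]) *
          (1 + X) ^ (i + j) +
      X * ∑ k ∈ Finset.Icc 1 (min n₁ m₁),
        ∑ j ∈ Finset.Icc 0 (m₁ - k), ∑ i ∈ Finset.Icc 0 (n₁ - k),
        ((m₁ - k).choose j * (n₂ + k - 1).choose j * (m₂ + k - 1).choose i *
          (n₁ - k).choose i : ℤ[X]) * (1 + X) ^ (i + j) := by
  simp only [ZZ_ribbon, delannoy_mul_delannoy]

theorem aeval_ZZ_ribbon {K : Type*} [Field K] [CharZero K] [TopologicalSpace K]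
    [IsTopologicalRing K] [T2Space K] (x : K) :
    aeval x (ZZ (ribbon n₁ n₂ m₁ m₂)) =
      ∑ k ∈ Finset.Icc 0 (min n₁ m₁),
        ₂F₁ (-m₁ + k : K) (-n₂ - k : K) (1 : K) (1 + x) *
          ₂F₁ (-n₁ + k : K) (-m₂ - k : K) (1 : K) (1 + x) +
      x * ∑ k ∈ Finset.Icc 1 (min n₁ m₁),
        ₂F₁ (-m₁ + k : K) (-n₂ + 1 - k : K) (1 : K) (1 + x) *
          ₂F₁ (-n₁ + k : K) (-m₂ + 1 - k : K) (1 : K) (1 + x) := by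
  simp only [ZZ_ribbon, map_add, map_sum, map_mul, aeval_X]
  congr 1
  · refine Finset.sum_congr rfl fun k hk => ?_
    obtain ⟨-, hk⟩ := Finset.mem_Icc.1 hk
    rw [delannoy_comm (m₂ + k), aeval_delannoy, aeval_delannoy,
      Nat.cast_sub (by omega : k ≤ m₁), Nat.cast_sub (by omega : k ≤ n₁)]
    push_cast
    congr 2 <;> ring
  · congr 1
    refine Finset.sum_congr rfl fun k hk => ?_
    obtain ⟨hk1, hk⟩ := Finset.mem_Icc.1 hk
    rw [delannoy_comm (m₂ + k - 1), aeval_delannoy, aeval_delannoy,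
      Nat.cast_sub (by omega : k ≤ m₁), Nat.cast_sub (by omega : k ≤ n₁),
      Nat.cast_sub (by omega : 1 ≤ n₂ + k), Nat.cast_sub (by omega : 1 ≤ m₂ + k)]
    push_cast
    congr 2 <;> ring

end Formulas

theorem mainTheorem1 :
    -- the ZZ polynomial of a ribbon in terms of those of parallelograms
    (∀ n₁ n₂ m₁ m₂ : ℕ,
      ZZ (ribbon n₁ n₂ m₁ m₂) =
        ∑ k ∈ Finset.Icc 0 (min n₁ m₁),
          ZZ (parallelogram (m₁ - k) (n₂ + k)) * ZZ (parallelogram (m₂ + k) (n₁ - k)) +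
        X * ∑ k ∈ Finset.Icc 1 (min n₁ m₁),
          ZZ (parallelogram (m₁ - k) (n₂ + k - 1)) * ZZ (parallelogram (m₂ + k - 1) (n₁ - k))) ∧
    -- the ZZ polynomial of a parallelogram
    (∀ m n : ℕ,
      ZZ (parallelogram m n) =
        ∑ j ∈ Finset.Icc 0 (min m n), (m.choose j * n.choose j : ℤ[X]) * (1 + X) ^ j) ∧
    (∀ (m n : ℕ) (x : ℂ),
      aeval x (ZZ (parallelogram m n)) = ₂F₁ (-m : ℂ) (-n : ℂ) (1 : ℂ) (1 + x)) ∧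
    -- the hypergeometric form for a ribbon
    (∀ (n₁ n₂ m₁ m₂ : ℕ) (x : ℂ),
      aeval x (ZZ (ribbon n₁ n₂ m₁ m₂)) =
        ∑ k ∈ Finset.Icc 0 (min n₁ m₁),
          ₂F₁ (-m₁ + k : ℂ) (-n₂ - k : ℂ) (1 : ℂ) (1 + x) *
            ₂F₁ (-n₁ + k : ℂ) (-m₂ - k : ℂ) (1 : ℂ) (1 + x) +
        x * ∑ k ∈ Finset.Icc 1 (min n₁ m₁),
          ₂F₁ (-m₁ + k : ℂ) (-n₂ + 1 - k : ℂ) (1 : ℂ) (1 + x) *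
            ₂F₁ (-n₁ + k : ℂ) (-m₂ + 1 - k : ℂ) (1 : ℂ) (1 + x)) ∧
    -- the triple binomial sum for a ribbon
    (∀ n₁ n₂ m₁ m₂ : ℕ,
      ZZ (ribbon n₁ n₂ m₁ m₂) =
        ∑ k ∈ Finset.Icc 0 (min n₁ m₁), ∑ j ∈ Finset.Icc 0 (m₁ - k), ∑ i ∈ Finset.Icc 0 (n₁ - k),
          ((m₁ - k).choose j * (n₂ + k).choose j * (m₂ + k).choose i * (n₁ - k).choose i : ℤ[X]) *
            (1 + X) ^ (i + j) +
        X * ∑ k ∈ Finset.Icc 1 (min n₁ m₁),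
          ∑ j ∈ Finset.Icc 0 (m₁ - k), ∑ i ∈ Finset.Icc 0 (n₁ - k),
          ((m₁ - k).choose j * (n₂ + k - 1).choose j * (m₂ + k - 1).choose i *
            (n₁ - k).choose i : ℤ[X]) * (1 + X) ^ (i + j)) ∧
    -- the triple binomial sum for `V(k, m, n)`
    (∀ k m n : ℕ, k ≤ m → k ≤ n →
      ZZ (ribbonV k m n) =
        ∑ s ∈ Finset.Icc 0 k, ∑ j ∈ Finset.Icc 0 (k - s), ∑ i ∈ Finset.Icc 0 (k - s),
          ((k - s).choose j * (n - k + s).choose j * (m - k + s).choose i *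
            (k - s).choose i : ℤ[X]) * (1 + X) ^ (i + j) +
        X * ∑ s ∈ Finset.Icc 1 k, ∑ j ∈ Finset.Icc 0 (k - s), ∑ i ∈ Finset.Icc 0 (k - s),
          ((k - s).choose j * (n - k + s - 1).choose j * (m - k + s - 1).choose i *
            (k - s).choose i : ℤ[X]) * (1 + X) ^ (i + j)) ∧
    -- the triple binomial sum for `V(k₁, k₂, m, n)`
    (∀ k₁ k₂ m n : ℕ, k₁ ≤ n → k₂ ≤ m →
      ZZ (ribbonV₂ k₁ k₂ m n) =
        ∑ k ∈ Finset.Icc 0 (min k₁ k₂),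
          ∑ j ∈ Finset.Icc 0 (k₂ - k), ∑ i ∈ Finset.Icc 0 (k₁ - k),
          ((k₂ - k).choose j * (n - k₁ + k).choose j * (m - k₂ + k).choose i *
            (k₁ - k).choose i : ℤ[X]) * (1 + X) ^ (i + j) +
        X * ∑ k ∈ Finset.Icc 1 (min k₁ k₂),
          ∑ j ∈ Finset.Icc 0 (k₂ - k), ∑ i ∈ Finset.Icc 0 (k₁ - k),
          ((k₂ - k).choose j * (n - k₁ + k - 1).choose j * (m - k₂ + k - 1).choose i *
            (k₁ - k).choose i : ℤ[X]) * (1 + X) ^ (i + j)) := by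
  refine ⟨fun n₁ n₂ m₁ m₂ => ?_, fun m n => ?_, fun m n x => ?_,
    fun n₁ n₂ m₁ m₂ => aeval_ZZ_ribbon n₁ n₂ m₁ m₂, ZZ_ribbon_eq_triple_sum, fun k m n _ _ => ?_,
    fun k₁ k₂ m n _ _ => ?_⟩
  · simp only [ZZ_parallelogram, ZZ_ribbon]
  · rw [ZZ_parallelogram, delannoy]
  · rw [ZZ_parallelogram, aeval_delannoy]
  · rw [ribbonV, ZZ_ribbon_eq_triple_sum, min_self]
  · rw [ribbonV₂, ZZ_ribbon_eq_triple_sum]
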